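/- Let $d\in\mathbb N$ and let $P,Q$ be subgaussian probability measures on $\mathbb R^d$, where $P$ is called subgaussian if $\int e^{\|x\|^2/(2d\sigma^2)}\,\mathrm dP(x)\le 2$ for some $\sigma>0$. For probability measures $\alpha,\beta$ on $\mathbb R^d$, a pair $(f,g)$ of functions $\mathbb R^d\to\mathbb R$ with $f\in L_1(\alpha)$, $g\in L_1(\beta)$ is called a pair of optimal potentials for $(\alpha,\beta)$ if it attains the supremum in the dual entropic optimal transport problem $$\sup_{f\in L_1(\alpha),\,g\in L_1(\beta)}\ \int f\,\mathrm d\alpha+\int g\,\mathrm d\beta-\iint e^{f(x)+g(y)-\frac12\|x-y\|^2}\,\mathrm d\alpha(x)\,\mathrm d\beta(y)+1 .$$ Let $X_1,X_2,\dots$ be i.i.d. with law $P$ and $Y_1,Y_2,\dots$ i.i.d. with law $Q$, defined on a common probability space, and let $P_n=\frac1n\sum_{i=1}^n\delta_{X_i}$, $Q_n=\frac1n\sum_{i=1}^n\delta_{Y_i}$ for $n\ge1$. Then there exist a (deterministic) pair $(f,g)$ of optimal potentials for $(P,Q)$ and, for every $n\ge 1$, a (random) pair $(f_n,g_n)$ of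 optimal potentials for $(P_n,Q_n)$ such that, almost surely, $f_n\to f$ and $g_n\to g$ uniformly on every compact subset of $\mathbb R^d$. Here $(f,g)$ and $(f_n,g_n)$ can be chosen such that the dual optimality conditions hold everywhere: for all $x,y\in\mathbb R^d$, $$\int e^{f(x)+g(y')-\frac12\|x-y'\|^2}\,\mathrm dQ(y')=1,\qquad \int e^{f(x')+g(y)-\frac12\|x'-y\|^2}\,\mathrm dP(x')=1,$$ and the same with $(f,g,P,Q)$ replaced by $(f_n,g_n,P_n,Q_n)$. -/

import Mathlib

open MeasureTheory ProbabilityTheory Filter Topology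
open scoped ENNReal

/-- `P` is `σ²`-subgaussian: `E_P exp (‖X‖² / (2 d σ²)) ≤ 2`, the expectation being taken in
`[0, ∞]`, so that its finiteness is part of the condition. -/
def IsSubgaussianWith {d : ℕ} (σ : ℝ) (P : Measure (EuclideanSpace ℝ (Fin d))) : Prop :=
  ∫⁻ x, ENNReal.ofReal (Real.exp (‖x‖ ^ 2 / (2 * d * σ ^ 2))) ∂P ≤ 2

/-- `P` is subgaussian if it is `σ²`-subgaussian for some `σ > 0`. (The degenerate value `σ = 0`
would only allow the point mass at the origin, which is `σ²`-subgaussian for every `σ > 0`.) -/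
def IsSubgaussian {d : ℕ} (P : Measure (EuclideanSpace ℝ (Fin d))) : Prop :=
  ∃ σ : ℝ, 0 < σ ∧ IsSubgaussianWith σ P

/-- The empirical measure `(1 / n) ∑_{i < n} δ_{x i}` of the first `n` terms of a sequence
(meant for `n ≥ 1`). -/
noncomputable def empiricalMeasure {E : Type*} [MeasurableSpace E] (x : ℕ → E) (n : ℕ) :
    Measure E :=
  (n : ℝ≥0∞)⁻¹ • ∑ i ∈ Finset.range n, Measure.dirac (x i)

/-- The objective of the dual problem of entropic optimal transport with cost `‖x - y‖² / 2`,
`∫ f dP + ∫ g dQ - ∫∫ exp (f x + g y - ‖x - y‖² / 2) dP dQ + 1`,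
for `f ∈ L¹(P)` and `g ∈ L¹(Q)`. It takes the value `-∞` when the exponential term has
infinite integral. -/
noncomputable def dualObjective {d : ℕ} (P Q : Measure (EuclideanSpace ℝ (Fin d)))
    (f g : EuclideanSpace ℝ (Fin d) → ℝ) : EReal :=
  ((∫ x, f x ∂P + ∫ y, g y ∂Q + 1 : ℝ) : EReal) -
    ((∫⁻ z, ENNReal.ofReal (Real.exp (f z.1 + g z.2 - ‖z.1 - z.2‖ ^ 2 / 2)) ∂(P.prod Q) : ℝ≥0∞) :
      EReal)

/-- `(f, g)` is a pair of optimal potentials for `(P, Q)`: it attains the supremum of the dual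
objective over `L¹(P) × L¹(Q)`. -/
structure IsOptimalPotentials {d : ℕ} (P Q : Measure (EuclideanSpace ℝ (Fin d)))
    (f g : EuclideanSpace ℝ (Fin d) → ℝ) : Prop where
  integrable_left : Integrable f P
  integrable_right : Integrable g Q
  isMax : ∀ f' g' : EuclideanSpace ℝ (Fin d) → ℝ, Integrable f' P → Integrable g' Q →
    dualObjective P Q f' g' ≤ dualObjective P Q f g

/-- The dual optimality conditions hold at every point of the space, and not only almost surely.
(A Bochner integral that equals `1` is the integral of an integrable function.) -/
structure DualOptimalityEverywhere {d : ℕ} (P Q : Measure (EuclideanSpace ℝ (Fin d)))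
    (f g : EuclideanSpace ℝ (Fin d) → ℝ) : Prop where
  left : ∀ x, ∫ y, Real.exp (f x + g y - ‖x - y‖ ^ 2 / 2) ∂Q = 1
  right : ∀ y, ∫ x, Real.exp (f x + g y - ‖x - y‖ ^ 2 / 2) ∂P = 1

/-! The proof combines compactness with uniqueness, and never needs a rate.

If `(f, g)` solves the dual equations at every point, then `gibbsDensity f g` is the density of a
coupling of `P` and `Q`. Passing to `(f', g')` multiplies it by `exp t`, where `t` is the sum of the
two increments. Integrating `1 + t ≤ exp t` gives optimality (`isOptimalPotentials`). Integrating `t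
* (exp t - 1) ≥ 0` gives uniqueness up to a constant, at every point of the space
(`exists_eq_add_const`).

Expanding the square, the first equation says that `exp (-(f x - ‖x‖² / 2))` is the Laplace
transform at `x` of `exp (g - ‖·‖² / 2) dQ`. After the normalisation `f 0 = 0`, this yields linear
upper bounds and Lipschitz bounds on balls for `f - ‖·‖² / 2` and `g - ‖·‖² / 2`, depending only on
exponential moments (`growth_of_apply_zero`, `sub_le_mul_norm_sub`).

Almost surely, empirical integrals of all continuous functions of exponential growth converge
(`ae_expMomentTendsto_empiricalMeasure`), so these bounds are uniform in `n`. Along any ultrafilter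
finer than `atTop` the empirical potentials then converge pointwise, and the equations pass to the
limit (`exists_ultrafilter_limit`). This produces potentials for `(P, Q)`; by uniqueness all
ultrafilter limits agree, so the whole sequence converges, and the Lipschitz bounds make this
uniform on compact sets. The empirical potentials themselves come from a finite-dimensional
minimisation (`exists_schroedinger_system`). -/

/-! ### Potentials satisfying the dual optimality conditions: optimality and uniqueness -/

/-- The density `exp (f x + g y - ‖x - y‖² / 2)` of the coupling associated with `(f, g)`. -/
noncomputable def gibbsDensity {d : ℕ} (f g : EuclideanSpace ℝ (Fin d) → ℝ)
    (z : EuclideanSpace ℝ (Fin d) × EuclideanSpace ℝ (Fin d)) : ℝ :=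
  Real.exp (f z.1 + g z.2 - ‖z.1 - z.2‖ ^ 2 / 2)

theorem gibbsDensity_pos {d : ℕ} (f g : EuclideanSpace ℝ (Fin d) → ℝ)
    (z : EuclideanSpace ℝ (Fin d) × EuclideanSpace ℝ (Fin d)) : 0 < gibbsDensity f g z :=
  Real.exp_pos _

theorem gibbsDensity_swap {d : ℕ} (f g : EuclideanSpace ℝ (Fin d) → ℝ)
    (z : EuclideanSpace ℝ (Fin d) × EuclideanSpace ℝ (Fin d)) :
    gibbsDensity f g z.swap = gibbsDensity g f z := by
  simp only [gibbsDensity, Prod.fst_swap, Prod.snd_swap, norm_sub_rev z.2 z.1]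
  ring_nf

theorem aestronglyMeasurable_gibbsDensity {d : ℕ} {P Q : Measure (EuclideanSpace ℝ (Fin d))}
    [SFinite P] [SFinite Q] {f g : EuclideanSpace ℝ (Fin d) → ℝ}
    (hf : AEStronglyMeasurable f P) (hg : AEStronglyMeasurable g Q) :
    AEStronglyMeasurable (gibbsDensity f g) (P.prod Q) := by
  have h : AEStronglyMeasurable
      (fun z : EuclideanSpace ℝ (Fin d) × EuclideanSpace ℝ (Fin d) =>
        f z.1 + g z.2 - ‖z.1 - z.2‖ ^ 2 / 2) (P.prod Q) :=
    ((hf.comp_fst).add hg.comp_snd).sub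
      (Continuous.aestronglyMeasurable (by fun_prop))
  exact Real.continuous_exp.comp_aestronglyMeasurable h

namespace DualOptimalityEverywhere

variable {d : ℕ} {P Q : Measure (EuclideanSpace ℝ (Fin d))}
  {f g f' g' : EuclideanSpace ℝ (Fin d) → ℝ}

theorem symm (h : DualOptimalityEverywhere P Q f g) : DualOptimalityEverywhere Q P g f where
  left x := by
    rw [← h.right x]
    congr 1; ext y; rw [norm_sub_rev]; ring_nf
  right x := by
    rw [← h.left x]
    congr 1; ext y; rw [norm_sub_rev]; ring_nf

theorem add_const (h : DualOptimalityEverywhere P Q f g) (c : ℝ) :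
    DualOptimalityEverywhere P Q (fun x => f x + c) (fun y => g y - c) where
  left x := by
    rw [← h.left x]
    congr 1; ext y; ring_nf
  right x := by
    rw [← h.right x]
    congr 1; ext y; ring_nf

theorem integrable_left (h : DualOptimalityEverywhere P Q f g) (x : EuclideanSpace ℝ (Fin d)) :
    Integrable (fun y => gibbsDensity f g (x, y)) Q :=
  Integrable.of_integral_ne_zero (by
    have := h.left x
    simp only [gibbsDensity]
    rw [this]; exact one_ne_zero)

theorem integral_gibbsDensity_left (h : DualOptimalityEverywhere P Q f g)
    (x : EuclideanSpace ℝ (Fin d)) : ∫ y, gibbsDensity f g (x, y) ∂Q = 1 :=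
  h.left x

variable [IsProbabilityMeasure P] [IsProbabilityMeasure Q]

/-- The fibre integral of the density is `1` for every `x`, so Tonelli reduces the claim to the
integrability of `u`: the first marginal of the coupling is `P`. -/
theorem integrable_fst_mul (h : DualOptimalityEverywhere P Q f g)
    (hf : AEStronglyMeasurable f P) (hg : AEStronglyMeasurable g Q)
    {u : EuclideanSpace ℝ (Fin d) → ℝ} (hu : Integrable u P) :
    Integrable (fun z => u z.1 * gibbsDensity f g z) (P.prod Q) := by
  rw [integrable_prod_iff (f := fun z => u z.1 * gibbsDensity f g z)
    (hu.aestronglyMeasurable.comp_fst.mul (aestronglyMeasurable_gibbsDensity hf hg))]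
  refine ⟨ae_of_all _ fun x => (h.integrable_left x).const_mul (u x), ?_⟩
  refine hu.norm.congr (ae_of_all _ fun x => ?_)
  simp only [norm_mul, Real.norm_of_nonneg (gibbsDensity_pos f g _).le]
  rw [integral_const_mul, h.integral_gibbsDensity_left, mul_one]

theorem integral_fst_mul (h : DualOptimalityEverywhere P Q f g)
    (hf : AEStronglyMeasurable f P) (hg : AEStronglyMeasurable g Q)
    {u : EuclideanSpace ℝ (Fin d) → ℝ} (hu : Integrable u P) :
    ∫ z, u z.1 * gibbsDensity f g z ∂(P.prod Q) = ∫ x, u x ∂P := by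
  rw [integral_prod _ (h.integrable_fst_mul hf hg hu)]
  simp only [integral_const_mul, h.integral_gibbsDensity_left, mul_one]

theorem integrable_snd_mul (h : DualOptimalityEverywhere P Q f g)
    (hf : AEStronglyMeasurable f P) (hg : AEStronglyMeasurable g Q)
    {u : EuclideanSpace ℝ (Fin d) → ℝ} (hu : Integrable u Q) :
    Integrable (fun z => u z.2 * gibbsDensity f g z) (P.prod Q) := by
  refine (h.symm.integrable_fst_mul hg hf hu).swap.congr (ae_of_all _ fun z => ?_)
  simp [gibbsDensity_swap]

theorem integral_snd_mul (h : DualOptimalityEverywhere P Q f g)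
    (hf : AEStronglyMeasurable f P) (hg : AEStronglyMeasurable g Q)
    {u : EuclideanSpace ℝ (Fin d) → ℝ} (hu : Integrable u Q) :
    ∫ z, u z.2 * gibbsDensity f g z ∂(P.prod Q) = ∫ y, u y ∂Q := by
  rw [← h.symm.integral_fst_mul hg hf hu, ← integral_prod_swap]
  simp [gibbsDensity_swap]

theorem integrable_gibbsDensity (h : DualOptimalityEverywhere P Q f g)
    (hf : AEStronglyMeasurable f P) (hg : AEStronglyMeasurable g Q) :
    Integrable (gibbsDensity f g) (P.prod Q) := by
  simpa using h.integrable_fst_mul hf hg (integrable_const (1 : ℝ))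

theorem integral_gibbsDensity (h : DualOptimalityEverywhere P Q f g)
    (hf : AEStronglyMeasurable f P) (hg : AEStronglyMeasurable g Q) :
    ∫ z, gibbsDensity f g z ∂(P.prod Q) = 1 := by
  simpa using h.integral_fst_mul hf hg (integrable_const (1 : ℝ))

theorem integrable_add_mul (h : DualOptimalityEverywhere P Q f g)
    (hf : AEStronglyMeasurable f P) (hg : AEStronglyMeasurable g Q)
    {u v : EuclideanSpace ℝ (Fin d) → ℝ} (hu : Integrable u P) (hv : Integrable v Q) :
    Integrable (fun z => (u z.1 + v z.2) * gibbsDensity f g z) (P.prod Q) := by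
  simp only [add_mul]
  exact (h.integrable_fst_mul hf hg hu).add (h.integrable_snd_mul hf hg hv)

theorem integral_add_mul (h : DualOptimalityEverywhere P Q f g)
    (hf : AEStronglyMeasurable f P) (hg : AEStronglyMeasurable g Q)
    {u v : EuclideanSpace ℝ (Fin d) → ℝ} (hu : Integrable u P) (hv : Integrable v Q) :
    ∫ z, (u z.1 + v z.2) * gibbsDensity f g z ∂(P.prod Q) = ∫ x, u x ∂P + ∫ y, v y ∂Q := by
  simp only [add_mul]
  rw [integral_add (h.integrable_fst_mul hf hg hu) (h.integrable_snd_mul hf hg hv),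
    h.integral_fst_mul hf hg hu, h.integral_snd_mul hf hg hv]

/-- Concavity of the dual problem in integrated form: the tangent-line bound for `exp` at `0`,
weighted by the coupling and evaluated through its marginals. -/
theorem one_add_le_integral_gibbsDensity (h : DualOptimalityEverywhere P Q f g)
    (hf : Integrable f P) (hg : Integrable g Q) (hf' : Integrable f' P) (hg' : Integrable g' Q)
    (hint : Integrable (gibbsDensity f' g') (P.prod Q)) :
    1 + (∫ x, f' x ∂P - ∫ x, f x ∂P) + (∫ y, g' y ∂Q - ∫ y, g y ∂Q) ≤
      ∫ z, gibbsDensity f' g' z ∂(P.prod Q) := by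
  have hm := hf.aestronglyMeasurable
  have hm' := hg.aestronglyMeasurable
  rw [← integral_sub' hf' hf, ← integral_sub' hg' hg, ← h.integral_gibbsDensity hm hm', add_assoc,
    ← h.integral_add_mul hm hm' (hf'.sub hf) (hg'.sub hg),
    ← integral_add (h.integrable_gibbsDensity hm hm')
      (h.integrable_add_mul hm hm' (hf'.sub hf) (hg'.sub hg))]
  refine integral_mono ((h.integrable_gibbsDensity hm hm').add
      (h.integrable_add_mul hm hm' (hf'.sub hf) (hg'.sub hg))) hint fun z => ?_
  have hz : gibbsDensity f' g' z =
      Real.exp ((f' - f) z.1 + (g' - g) z.2) * gibbsDensity f g z := by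
    simp only [gibbsDensity, ← Real.exp_add, Pi.sub_apply]
    ring_nf
  have := mul_le_mul_of_nonneg_right (Real.add_one_le_exp ((f' - f) z.1 + (g' - g) z.2))
    (gibbsDensity_pos f g z).le
  change gibbsDensity f g z + ((f' - f) z.1 + (g' - g) z.2) * gibbsDensity f g z ≤ _
  rw [hz]
  linarith

theorem isOptimalPotentials (h : DualOptimalityEverywhere P Q f g)
    (hf : Integrable f P) (hg : Integrable g Q) : IsOptimalPotentials P Q f g where
  integrable_left := hf
  integrable_right := hg
  isMax f' g' hf' hg' := by
    have key : ∀ {a b : EuclideanSpace ℝ (Fin d) → ℝ}, Integrable (gibbsDensity a b) (P.prod Q) →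
        dualObjective P Q a b = ((∫ x, a x ∂P + ∫ y, b y ∂Q + 1 -
          ∫ z, gibbsDensity a b z ∂(P.prod Q) : ℝ) : EReal) := by
      intro a b hab
      rw [EReal.coe_sub, dualObjective]
      congr 1
      change ((∫⁻ z, ENNReal.ofReal (gibbsDensity a b z) ∂(P.prod Q) : ℝ≥0∞) : EReal) = _
      rw [← ofReal_integral_eq_lintegral_ofReal hab
        (ae_of_all _ fun z => (gibbsDensity_pos a b z).le), EReal.coe_ennreal_ofReal,
        max_eq_left (integral_nonneg fun z => (gibbsDensity_pos a b z).le)]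
    by_cases hint : Integrable (gibbsDensity f' g') (P.prod Q)
    · rw [key hint, key (h.integrable_gibbsDensity hf.1 hg.1), EReal.coe_le_coe_iff,
        h.integral_gibbsDensity hf.1 hg.1]
      linarith [h.one_add_le_integral_gibbsDensity hf hg hf' hg' hint]
    -- A competitor with infinite exponential term has objective `⊥`.
    · have htop : ∫⁻ z, ENNReal.ofReal (gibbsDensity f' g' z) ∂(P.prod Q) = ⊤ := by
        by_contra hne
        exact hint ((lintegral_ofReal_ne_top_iff_integrable
          (aestronglyMeasurable_gibbsDensity hf'.1 hg'.1)
          (ae_of_all _ fun z => (gibbsDensity_pos f' g' z).le)).1 hne)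
      have : dualObjective P Q f' g' = ⊥ := by
        rw [dualObjective]
        change _ - ((∫⁻ z, ENNReal.ofReal (gibbsDensity f' g' z) ∂(P.prod Q) : ℝ≥0∞) : EReal) = _
        rw [htop, EReal.coe_ennreal_top, EReal.sub_top]
      rw [this]
      exact bot_le

/-- Comparison with the zero potentials, whose exponential term is at most `1` because the cost is
nonnegative. -/
theorem integral_add_integral_nonneg (h : DualOptimalityEverywhere P Q f g)
    (hf : Integrable f P) (hg : Integrable g Q) : 0 ≤ ∫ x, f x ∂P + ∫ y, g y ∂Q := by
  have hle : ∀ z : EuclideanSpace ℝ (Fin d) × EuclideanSpace ℝ (Fin d),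
      gibbsDensity (fun _ => 0) (fun _ => 0) z ≤ 1 := fun z => by
    simp only [gibbsDensity, Real.exp_le_one_iff]
    nlinarith [sq_nonneg ‖z.1 - z.2‖]
  have hint : Integrable (gibbsDensity (d := d) (fun _ => 0) (fun _ => 0)) (P.prod Q) :=
    (integrable_const (1 : ℝ)).mono'
      (aestronglyMeasurable_gibbsDensity aestronglyMeasurable_const aestronglyMeasurable_const)
      (ae_of_all _ fun z => by
        rw [Real.norm_of_nonneg (gibbsDensity_pos _ _ z).le]; exact hle z)
  have h1 := h.one_add_le_integral_gibbsDensity hf hg (integrable_const 0) (integrable_const 0) hint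
  have h2 : ∫ z, gibbsDensity (d := d) (fun _ => 0) (fun _ => 0) z ∂(P.prod Q) ≤ 1 := by
    simpa using integral_mono hint (integrable_const (1 : ℝ)) hle
  simp only [integral_zero] at h1
  linarith

/-- Potentials are unique up to an additive constant. -/
theorem exists_eq_add_const (h : DualOptimalityEverywhere P Q f g)
    (h' : DualOptimalityEverywhere P Q f' g') (hf : Integrable f P) (hg : Integrable g Q)
    (hf' : Integrable f' P) (hg' : Integrable g' Q) :
    ∃ c : ℝ, (∀ x, f' x = f x + c) ∧ ∀ y, g' y = g y - c := by
  set u : EuclideanSpace ℝ (Fin d) → ℝ := f' - f with hu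
  set v : EuclideanSpace ℝ (Fin d) → ℝ := g' - g with hv
  have hui : Integrable u P := hf'.sub hf
  have hvi : Integrable v Q := hg'.sub hg
  -- Both couplings have the same marginals, so `F` integrates to zero. It is also `t * (exp t - 1)`
  -- times a positive density, hence nonnegative, which forces `t = 0` almost everywhere.
  set F : EuclideanSpace ℝ (Fin d) × EuclideanSpace ℝ (Fin d) → ℝ :=
    fun z => (u z.1 + v z.2) * gibbsDensity f' g' z - (u z.1 + v z.2) * gibbsDensity f g z with hF
  have hFexp : ∀ z, F z =
      (u z.1 + v z.2) * (Real.exp (u z.1 + v z.2) - 1) * gibbsDensity f g z := by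
    intro z
    have hz : gibbsDensity f' g' z = Real.exp (u z.1 + v z.2) * gibbsDensity f g z := by
      simp only [gibbsDensity, ← Real.exp_add, hu, hv, Pi.sub_apply]
      ring_nf
    simp only [hF, hz]
    ring
  have hF0 : 0 ≤ F := by
    intro z
    rw [hFexp]
    refine mul_nonneg ?_ (gibbsDensity_pos f g z).le
    rcases le_total 0 (u z.1 + v z.2) with ht | ht
    · exact mul_nonneg ht (by linarith [Real.one_le_exp ht])
    · exact mul_nonneg_of_nonpos_of_nonpos ht (by linarith [Real.exp_le_one_iff.2 ht])
  have hFi : Integrable F (P.prod Q) :=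
    (h'.integrable_add_mul hf'.1 hg'.1 hui hvi).sub (h.integrable_add_mul hf.1 hg.1 hui hvi)
  have hFz : ∫ z, F z ∂(P.prod Q) = 0 := by
    rw [hF, integral_sub (h'.integrable_add_mul hf'.1 hg'.1 hui hvi)
      (h.integrable_add_mul hf.1 hg.1 hui hvi), h'.integral_add_mul hf'.1 hg'.1 hui hvi,
      h.integral_add_mul hf.1 hg.1 hui hvi, sub_self]
  have hae : ∀ᵐ z ∂(P.prod Q), u z.1 + v z.2 = 0 := by
    filter_upwards [(integral_eq_zero_iff_of_nonneg hF0 hFi).1 hFz] with z hz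
    rw [hFexp, Pi.zero_apply, mul_eq_zero, mul_eq_zero] at hz
    rcases hz with (hz | hz) | hz
    · exact hz
    · exact Real.exp_eq_one_iff _ |>.1 (by linarith)
    · exact absurd hz (gibbsDensity_pos f g z).ne'
  -- On the fibre over `x₀`, `v = -u x₀` holds `Q`-almost everywhere. The equations, valid at every
  -- point, then promote this to an identity on the whole space.
  obtain ⟨x₀, hx₀⟩ := (Measure.ae_ae_of_ae_prod hae).exists
  have hfc : ∀ x, f' x = f x + u x₀ := by
    intro x
    have h1 := h'.integral_gibbsDensity_left x
    have h2 : ∫ y, gibbsDensity f' g' (x, y) ∂Q =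
        ∫ y, Real.exp (u x - u x₀) * gibbsDensity f g (x, y) ∂Q := by
      refine integral_congr_ae ?_
      filter_upwards [hx₀] with y hy
      simp only [gibbsDensity, ← Real.exp_add, hu, hv, Pi.sub_apply] at hy ⊢
      congr 1
      linarith
    rw [h2, integral_const_mul, h.integral_gibbsDensity_left, mul_one, Real.exp_eq_one_iff] at h1
    simp only [hu, Pi.sub_apply] at h1 ⊢
    linarith
  refine ⟨u x₀, hfc, fun y => ?_⟩
  have h1 := h'.symm.integral_gibbsDensity_left y
  have h2 : ∫ x, gibbsDensity g' f' (y, x) ∂P =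
      ∫ x, Real.exp (v y + u x₀) * gibbsDensity g f (y, x) ∂P := by
    congr 1
    ext x
    simp only [gibbsDensity, ← Real.exp_add, hv, Pi.sub_apply, hfc x]
    congr 1
    ring
  rw [h2, integral_const_mul, h.symm.integral_gibbsDensity_left, mul_one,
    Real.exp_eq_one_iff] at h1
  simp only [hv, Pi.sub_apply] at h1
  linarith

end DualOptimalityEverywhere

/-! ### A priori bounds for potentials -/

/-- `E k` is an upper bound for the finite exponential moment `∫ exp (k ‖x‖) dP`, for all `k`. -/
structure IsExpMomentBound {d : ℕ} (E : ℝ → ℝ) (P : Measure (EuclideanSpace ℝ (Fin d))) :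
    Prop where
  integrable : ∀ k, Integrable (fun x => Real.exp (k * ‖x‖)) P
  le : ∀ k, ∫ x, Real.exp (k * ‖x‖) ∂P ≤ E k

theorem IsExpMomentBound.one_le {d : ℕ} {E : ℝ → ℝ} {P : Measure (EuclideanSpace ℝ (Fin d))}
    [IsProbabilityMeasure P] (h : IsExpMomentBound E P) {k : ℝ} (hk : 0 ≤ k) : 1 ≤ E k := by
  refine le_trans ?_ (h.le k)
  have := integral_mono (integrable_const (1 : ℝ)) (h.integrable k) fun x =>
    Real.one_le_exp (mul_nonneg hk (norm_nonneg x))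
  simpa using this

namespace DualOptimalityEverywhere

variable {d : ℕ} {P Q : Measure (EuclideanSpace ℝ (Fin d))}
  {f g : EuclideanSpace ℝ (Fin d) → ℝ} {E : ℝ → ℝ} {A R : ℝ}

theorem gibbsDensity_eq_exp (f g : EuclideanSpace ℝ (Fin d) → ℝ)
    (x y : EuclideanSpace ℝ (Fin d)) :
    gibbsDensity f g (x, y) = Real.exp (f x - ‖x‖ ^ 2 / 2) *
      Real.exp (g y - ‖y‖ ^ 2 / 2 + inner ℝ x y) := by
  rw [gibbsDensity, ← Real.exp_add, norm_sub_sq_real]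
  ring_nf

theorem integrable_exp_inner (h : DualOptimalityEverywhere P Q f g)
    (x : EuclideanSpace ℝ (Fin d)) :
    Integrable (fun y => Real.exp (g y - ‖y‖ ^ 2 / 2 + inner ℝ x y)) Q := by
  have := (h.integrable_left x).const_mul (Real.exp (-(f x - ‖x‖ ^ 2 / 2)))
  refine this.congr (ae_of_all _ fun y => ?_)
  simp only [gibbsDensity_eq_exp]
  rw [← mul_assoc, ← Real.exp_add]
  simp

theorem integral_exp_inner (h : DualOptimalityEverywhere P Q f g)
    (x : EuclideanSpace ℝ (Fin d)) :
    ∫ y, Real.exp (g y - ‖y‖ ^ 2 / 2 + inner ℝ x y) ∂Q = Real.exp (-(f x - ‖x‖ ^ 2 / 2)) := by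
  have := h.integral_gibbsDensity_left x
  simp only [gibbsDensity_eq_exp] at this
  rw [integral_const_mul] at this
  rw [Real.exp_neg]
  exact eq_inv_of_mul_eq_one_right this

/-- Linearising the exponential in the equation at `x` plays the role of Jensen's inequality: the
two constants `1` cancel and the mean of `g` remains. The terms `‖y‖² / 2` and `‖x‖ * ‖y‖` are
absorbed by `(1 + ‖x‖) * exp ‖y‖`. -/
theorem le_of_isExpMomentBound [IsProbabilityMeasure Q] (h : DualOptimalityEverywhere P Q f g)
    (hQ : IsExpMomentBound E Q) (hg : Integrable g Q) (x : EuclideanSpace ℝ (Fin d)) :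
    f x - ‖x‖ ^ 2 / 2 ≤ -∫ y, g y ∂Q + E 1 * (1 + ‖x‖) := by
  have hi₀ : Integrable (fun y => (f x - ‖x‖ ^ 2 / 2 + 1) + g y) Q := (integrable_const _).add hg
  have hi : Integrable (fun y => (f x - ‖x‖ ^ 2 / 2 + 1) + g y -
      (1 + ‖x‖) * Real.exp (1 * ‖y‖)) Q := hi₀.sub ((hQ.integrable 1).const_mul _)
  have hle : ∀ y, (f x - ‖x‖ ^ 2 / 2 + 1) + g y - (1 + ‖x‖) * Real.exp (1 * ‖y‖) ≤
      gibbsDensity f g (x, y) := by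
    intro y
    have h1 := Real.add_one_le_exp (f x + g y - ‖x - y‖ ^ 2 / 2)
    have h2 := Real.quadratic_le_exp_of_nonneg (norm_nonneg y)
    have h3 : -(‖x‖ * ‖y‖) ≤ inner ℝ x y := (abs_le.1 (abs_real_inner_le_norm x y)).1
    have h4 : ‖x‖ * ‖y‖ ≤ ‖x‖ * Real.exp ‖y‖ :=
      mul_le_mul_of_nonneg_left (by nlinarith [norm_nonneg y]) (norm_nonneg x)
    rw [gibbsDensity]
    rw [norm_sub_sq_real] at h1 ⊢
    rw [one_mul]
    simp only at h1 ⊢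
    nlinarith [norm_nonneg y]
  have h1 := integral_mono hi (h.integrable_left x) hle
  rw [h.integral_gibbsDensity_left, integral_sub hi₀
    ((hQ.integrable 1).const_mul _), integral_add (integrable_const _) hg, integral_const_mul] at h1
  simp only [integral_const, probReal_univ, smul_eq_mul, one_mul] at h1
  have h2 := mul_le_mul_of_nonneg_left (hQ.le 1) (by positivity : 0 ≤ 1 + ‖x‖)
  simp only [one_mul] at h2
  linarith

/-- The growth of `g` bounds the Laplace transform from above, which is a lower bound for `f`. -/
theorem exp_neg_le (h : DualOptimalityEverywhere P Q f g) (hQ : IsExpMomentBound E Q)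
    (hg : ∀ y, g y - ‖y‖ ^ 2 / 2 ≤ A * (1 + ‖y‖)) (x : EuclideanSpace ℝ (Fin d)) :
    Real.exp (-(f x - ‖x‖ ^ 2 / 2)) ≤ Real.exp A * E (A + ‖x‖) := by
  rw [← h.integral_exp_inner x]
  refine le_trans ?_ (mul_le_mul_of_nonneg_left (hQ.le _) (Real.exp_pos A).le)
  rw [← integral_const_mul]
  refine integral_mono (h.integrable_exp_inner x) ((hQ.integrable _).const_mul _) fun y => ?_
  simp only
  rw [← Real.exp_add]
  refine Real.exp_le_exp.2 ?_
  nlinarith [hg y, real_inner_le_norm x y]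

/-- The Laplace transform is Lipschitz on balls, since differentiating it brings down a factor `‖y‖
≤ exp ‖y‖`; this is the `+ 1` in the argument of `E`. Taking the logarithm costs the factor `exp φ ≤
exp (A * (1 + R))`. -/
theorem sub_le_mul_norm_sub (h : DualOptimalityEverywhere P Q f g) (hQ : IsExpMomentBound E Q)
    (hA : 0 ≤ A) (hf : ∀ x, f x - ‖x‖ ^ 2 / 2 ≤ A * (1 + ‖x‖))
    (hg : ∀ y, g y - ‖y‖ ^ 2 / 2 ≤ A * (1 + ‖y‖)) {x x' : EuclideanSpace ℝ (Fin d)}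
    (hx : ‖x‖ ≤ R) (hx' : ‖x'‖ ≤ R) :
    (f x - ‖x‖ ^ 2 / 2) - (f x' - ‖x'‖ ^ 2 / 2) ≤
      Real.exp (A * (1 + R)) * (Real.exp A * E (A + R + 1)) * ‖x - x'‖ := by
  set φ := f x - ‖x‖ ^ 2 / 2 with hφ
  set φ' := f x' - ‖x'‖ ^ 2 / 2 with hφ'
  have hu : Real.exp (-φ') - Real.exp (-φ) ≤ (Real.exp A * E (A + R + 1)) * ‖x - x'‖ := by
    rw [← h.integral_exp_inner x, ← h.integral_exp_inner x',
      ← integral_sub (h.integrable_exp_inner x') (h.integrable_exp_inner x)]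
    have h1 : Real.exp A * ‖x - x'‖ * ∫ y, Real.exp ((A + R + 1) * ‖y‖) ∂Q ≤
        Real.exp A * E (A + R + 1) * ‖x - x'‖ := by
      have := mul_le_mul_of_nonneg_left (hQ.le (A + R + 1))
        (by positivity : 0 ≤ Real.exp A * ‖x - x'‖)
      linarith
    refine le_trans ?_ h1
    rw [← integral_const_mul]
    refine integral_mono ((h.integrable_exp_inner x').sub (h.integrable_exp_inner x))
      ((hQ.integrable _).const_mul _) fun y => ?_
    set a := g y - ‖y‖ ^ 2 / 2 + inner ℝ x' y with ha
    set b := g y - ‖y‖ ^ 2 / 2 + inner ℝ x y with hb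
    have hab : Real.exp a - Real.exp b ≤ Real.exp a * (a - b) := by
      have : Real.exp b = Real.exp a * Real.exp (b - a) := by rw [← Real.exp_add]; ring_nf
      rw [this]
      nlinarith [Real.add_one_le_exp (b - a), Real.exp_pos a]
    have hab' : a - b ≤ ‖x - x'‖ * Real.exp ‖y‖ := by
      have h2 : a - b = inner ℝ (x' - x) y := by rw [ha, hb, inner_sub_left]; ring
      rw [h2]
      refine (real_inner_le_norm _ _).trans ?_
      rw [norm_sub_rev]
      exact mul_le_mul_of_nonneg_left (by linarith [Real.add_one_le_exp ‖y‖]) (norm_nonneg _)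
    have ha' : a ≤ A + (A + R) * ‖y‖ := by
      nlinarith [hg y, real_inner_le_norm x' y, norm_nonneg y]
    calc Real.exp a - Real.exp b ≤ Real.exp a * (‖x - x'‖ * Real.exp ‖y‖) :=
          hab.trans (mul_le_mul_of_nonneg_left hab' (Real.exp_pos a).le)
      _ ≤ Real.exp (A + (A + R) * ‖y‖) * (‖x - x'‖ * Real.exp ‖y‖) :=
          mul_le_mul_of_nonneg_right (Real.exp_le_exp.2 ha') (by positivity)
      _ = Real.exp A * ‖x - x'‖ * Real.exp ((A + R + 1) * ‖y‖) := by
          rw [show (A + R + 1) * ‖y‖ = (A + R) * ‖y‖ + ‖y‖ by ring, Real.exp_add, Real.exp_add]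
          ring
  have hφA : φ ≤ A * (1 + R) := (hf x).trans (by gcongr)
  have h2 : φ - φ' ≤ Real.exp φ * (Real.exp (-φ') - Real.exp (-φ)) := by
    rw [mul_sub, ← Real.exp_add, ← Real.exp_add, add_neg_cancel, Real.exp_zero]
    linarith [Real.add_one_le_exp (φ + -φ')]
  have h3 : 0 ≤ Real.exp A * E (A + R + 1) * ‖x - x'‖ := by
    have : 0 ≤ E (A + R + 1) :=
      (integral_nonneg fun y => (Real.exp_pos _).le).trans (hQ.le (A + R + 1))
    positivity
  calc φ - φ' ≤ Real.exp φ * (Real.exp (-φ') - Real.exp (-φ)) := h2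
    _ ≤ Real.exp φ * (Real.exp A * E (A + R + 1) * ‖x - x'‖) :=
        mul_le_mul_of_nonneg_left hu (Real.exp_pos φ).le
    _ ≤ Real.exp (A * (1 + R)) * (Real.exp A * E (A + R + 1) * ‖x - x'‖) :=
        mul_le_mul_of_nonneg_right (Real.exp_le_exp.2 hφA) h3
    _ = _ := by ring

variable [IsProbabilityMeasure P] [IsProbabilityMeasure Q]

/-- The upper bounds for `f` and `g` contain the unknown means `∫ g` and `∫ f`. Since the means have
nonnegative sum, only `∫ g` has to be controlled. The normalisation at `0` bounds it on both sides:
above through the bound for `f`, below through the Laplace transform of the shifted pair. -/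
theorem growth_of_apply_zero (h : DualOptimalityEverywhere P Q f g)
    (hP : IsExpMomentBound E P) (hQ : IsExpMomentBound E Q) (hf : Integrable f P)
    (hg : Integrable g Q) (h0 : f 0 = 0) :
    (∀ x, f x - ‖x‖ ^ 2 / 2 ≤ (2 * E 1 + Real.log (E (E 1))) * (1 + ‖x‖)) ∧
      ∀ y, g y - ‖y‖ ^ 2 / 2 ≤ (2 * E 1 + Real.log (E (E 1))) * (1 + ‖y‖) := by
  have hE : 1 ≤ E 1 := hP.one_le zero_le_one
  have hEE : 1 ≤ E (E 1) := hP.one_le (by linarith)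
  have hlog : 0 ≤ Real.log (E (E 1)) := Real.log_nonneg hEE
  have hab := h.integral_add_integral_nonneg hf hg
  have hφ := h.le_of_isExpMomentBound hQ hg
  have hψ := h.symm.le_of_isExpMomentBound hP hf
  have hsh := (h.add_const (∫ y, g y ∂Q)).exp_neg_le hQ (A := E 1)
    (fun y => by have := hψ y; linarith) 0
  simp only [h0, norm_zero, add_zero] at hsh
  have hb1 := hφ 0
  simp only [h0, norm_zero] at hb1
  have hb2 : -(∫ y, g y ∂Q) ≤ E 1 + Real.log (E (E 1)) := by
    have := Real.log_le_log (Real.exp_pos _) hsh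
    rw [Real.log_exp, Real.log_mul (Real.exp_pos _).ne' (by linarith), Real.log_exp] at this
    linarith
  constructor
  · intro x
    have := hφ x
    nlinarith [norm_nonneg x, mul_nonneg hlog (norm_nonneg x),
      mul_nonneg (zero_le_one.trans hE) (norm_nonneg x)]
  · intro y
    have := hψ y
    nlinarith [norm_nonneg y, mul_nonneg hlog (norm_nonneg y),
      mul_nonneg (zero_le_one.trans hE) (norm_nonneg y)]

end DualOptimalityEverywhere

/-! ### Limits of potentials -/

section LocallyLipschitz

variable {V : Type*} [SeminormedAddCommGroup V]

theorem continuous_of_lipschitz_on_balls {F : V → ℝ} {L : ℝ → ℝ}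
    (hL : ∀ R x x', ‖x‖ ≤ R → ‖x'‖ ≤ R → F x - F x' ≤ L R * ‖x - x'‖) : Continuous F := by
  refine continuous_iff_continuousAt.2 fun x => ?_
  refine tendsto_iff_dist_tendsto_zero.2 ?_
  have hlim : Tendsto (fun y => L (‖x‖ + 1) * ‖y - x‖) (𝓝 x) (𝓝 0) := by
    have : Continuous fun y => L (‖x‖ + 1) * ‖y - x‖ := by fun_prop
    simpa using this.tendsto x
  refine squeeze_zero' (Eventually.of_forall fun _ => dist_nonneg) ?_ hlim
  filter_upwards [Metric.ball_mem_nhds x one_pos] with y hy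
  have hy' : ‖y‖ ≤ ‖x‖ + 1 := by
    have h1 := norm_add_le x (y - x)
    rw [add_sub_cancel] at h1
    rw [mem_ball_iff_norm] at hy
    linarith
  have h1 := hL _ y x hy' (by linarith)
  have h2 := hL _ x y (by linarith) hy'
  rw [norm_sub_rev x y] at h2
  rw [Real.dist_eq, abs_le]
  constructor <;> linarith

/-- Equicontinuity on a finite net of `K`. The sign of `L R` is not prescribed, hence the `|L R| +
1` in the mesh. -/
theorem tendstoUniformlyOn_of_lipschitz_on_balls {ι : Type*} {l : Filter ι} [l.NeBot]
    {F : ι → V → ℝ} {F' : V → ℝ} {L : ℝ → ℝ}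
    (hL : ∀ i R x x', ‖x‖ ≤ R → ‖x'‖ ≤ R → F i x - F i x' ≤ L R * ‖x - x'‖)
    (hF : ∀ x, Tendsto (fun i => F i x) l (𝓝 (F' x))) {K : Set V} (hK : IsCompact K) :
    TendstoUniformlyOn F F' l K := by
  have hL' : ∀ R x x', ‖x‖ ≤ R → ‖x'‖ ≤ R → F' x - F' x' ≤ L R * ‖x - x'‖ := fun R x x' hx hx' =>
    le_of_tendsto ((hF x).sub (hF x')) (Eventually.of_forall fun i => hL i R x x' hx hx')
  rw [Metric.tendstoUniformlyOn_iff]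
  intro ε hε
  obtain ⟨R, hR⟩ := hK.isBounded.exists_norm_le
  set δ := ε / (3 * (|L R| + 1)) with hδ
  have hδ0 : 0 < δ := by positivity
  have hδ' : |L R| * δ < ε / 3 := by
    have : (|L R| + 1) * δ = ε / 3 := by rw [hδ]; field_simp
    linarith
  obtain ⟨t, htK, htf, hcov⟩ := hK.finite_cover_balls hδ0
  have hev : ∀ᶠ i in l, ∀ c ∈ t, dist (F i c) (F' c) < ε / 3 :=
    (Filter.eventually_all_finite htf).2 fun c _ =>
      (Metric.tendsto_nhds.1 (hF c)) _ (by positivity)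
  filter_upwards [hev] with i hi x hx
  obtain ⟨c, hc, hxc⟩ := Set.mem_iUnion₂.1 (hcov hx)
  have hxc' : L R * ‖x - c‖ < ε / 3 := by
    rw [mem_ball_iff_norm] at hxc
    calc L R * ‖x - c‖ ≤ |L R| * ‖x - c‖ := by gcongr; exact le_abs_self _
      _ ≤ |L R| * δ := by gcongr
      _ < ε / 3 := hδ'
  have h1 := hL i R x c (hR x hx) (hR c (htK hc))
  have h2 := hL i R c x (hR c (htK hc)) (hR x hx)
  have h3 := hL' R x c (hR x hx) (hR c (htK hc))
  have h4 := hL' R c x (hR c (htK hc)) (hR x hx)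
  rw [norm_sub_rev c x] at h2 h4
  have h5 := hi c hc
  rw [Real.dist_eq, abs_lt] at h5 ⊢
  constructor <;> linarith [h5.1, h5.2]

end LocallyLipschitz

/-- Convergence of the integrals of all continuous functions of at most exponential growth. -/
def ExpMomentTendsto {d : ℕ} (Pn : ℕ → Measure (EuclideanSpace ℝ (Fin d)))
    (P : Measure (EuclideanSpace ℝ (Fin d))) : Prop :=
  ∀ h : EuclideanSpace ℝ (Fin d) → ℝ, Continuous h →
    (∃ C k : ℝ, ∀ x, |h x| ≤ C * Real.exp (k * ‖x‖)) →
    Tendsto (fun n => ∫ x, h x ∂(Pn n)) atTop (𝓝 (∫ x, h x ∂P))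

theorem Real.abs_exp_sub_exp_le {a b c : ℝ} (ha : a ≤ c) (hb : b ≤ c) :
    |Real.exp a - Real.exp b| ≤ |a - b| * Real.exp c := by
  have key : ∀ {a b : ℝ}, a ≤ c → b ≤ a → Real.exp a - Real.exp b ≤ (a - b) * Real.exp c := by
    intro a b ha hba
    have h1 : Real.exp b = Real.exp a * Real.exp (b - a) := by rw [← Real.exp_add]; ring_nf
    have h2 : Real.exp a - Real.exp b ≤ (a - b) * Real.exp a := by
      rw [h1]
      nlinarith [Real.add_one_le_exp (b - a), Real.exp_pos a]
    exact h2.trans (mul_le_mul_of_nonneg_left (Real.exp_le_exp.2 ha) (by linarith))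
  rcases le_total b a with h | h
  · rw [abs_of_nonneg (sub_nonneg.2 (Real.exp_le_exp.2 h)), abs_of_nonneg (sub_nonneg.2 h)]
    exact key ha h
  · rw [abs_sub_comm, abs_sub_comm a b, abs_of_nonneg (sub_nonneg.2 (Real.exp_le_exp.2 h)),
      abs_of_nonneg (sub_nonneg.2 h)]
    exact key hb h

/-! ### Continuous tail cutoffs -/

section Cutoff

variable {d : ℕ}

/-- A continuous function with values in `[0, 1]` that vanishes on the ball of radius `R` and
equals `1` outside of the ball of radius `R + 1`. -/
noncomputable def tailCutoff (R : ℝ) (x : EuclideanSpace ℝ (Fin d)) : ℝ :=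
  min 1 (max 0 (‖x‖ - R))

theorem continuous_tailCutoff (R : ℝ) : Continuous (tailCutoff (d := d) R) := by
  unfold tailCutoff; fun_prop

theorem tailCutoff_nonneg (R : ℝ) (x : EuclideanSpace ℝ (Fin d)) : 0 ≤ tailCutoff R x :=
  le_min zero_le_one (le_max_left _ _)

theorem tailCutoff_le_one (R : ℝ) (x : EuclideanSpace ℝ (Fin d)) : tailCutoff R x ≤ 1 :=
  min_le_left _ _

theorem tailCutoff_eq_one {R : ℝ} {x : EuclideanSpace ℝ (Fin d)} (h : R + 1 ≤ ‖x‖) :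
    tailCutoff R x = 1 :=
  min_eq_left (le_max_of_le_right (by linarith))

theorem tailCutoff_eq_zero {R : ℝ} {x : EuclideanSpace ℝ (Fin d)} (h : ‖x‖ ≤ R) :
    tailCutoff R x = 0 := by
  rw [tailCutoff, max_eq_left (by linarith), min_eq_right zero_le_one]

/-- Because the cutoff is continuous, a small tail of the limit measure transfers to all late
measures of a converging sequence. -/
theorem exists_integral_tailCutoff_lt {P : Measure (EuclideanSpace ℝ (Fin d))}
    {G : EuclideanSpace ℝ (Fin d) → ℝ} (hG : Integrable G P) {ε : ℝ} (hε : 0 < ε) :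
    ∃ m : ℕ, ∫ x, tailCutoff m x * G x ∂P < ε := by
  have h : Tendsto (fun m : ℕ => ∫ x, tailCutoff m x * G x ∂P) atTop
      (𝓝 (∫ _, (0 : ℝ) ∂P)) := by
    refine tendsto_integral_of_dominated_convergence (fun x => ‖G x‖)
      (fun m => (continuous_tailCutoff _).aestronglyMeasurable.mul hG.1) hG.norm
      (fun m => ae_of_all _ fun x => ?_) (ae_of_all _ fun x => ?_)
    · rw [norm_mul, Real.norm_of_nonneg (tailCutoff_nonneg _ x)]
      exact mul_le_of_le_one_left (norm_nonneg _) (tailCutoff_le_one _ x)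
    · refine tendsto_const_nhds.congr' ?_
      obtain ⟨N, hN⟩ := exists_nat_ge ‖x‖
      filter_upwards [eventually_ge_atTop N] with m hm
      rw [tailCutoff_eq_zero (hN.trans (by exact_mod_cast hm)), zero_mul]
  rw [integral_zero] at h
  exact (h.eventually (gt_mem_nhds hε)).exists

end Cutoff

/-! ### Passage to the limit in exponential integrals -/

section Limit

variable {d : ℕ} {Qn : ℕ → Measure (EuclideanSpace ℝ (Fin d))}
  {Q : Measure (EuclideanSpace ℝ (Fin d))} {E E' : ℝ → ℝ} {A : ℝ}

/-- Passage to the limit in `∫ exp (ψ n) dQn n` when `ψ n` grows at most linearly and converges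
locally uniformly. -/
theorem tendsto_integral_exp_of_tendstoUniformlyOn {l : Filter ℕ} (hl : l ≤ atTop)
    [l.NeBot] (hQt : ExpMomentTendsto Qn Q) (hQn : ∀ n, IsExpMomentBound E (Qn n))
    (hQ : IsExpMomentBound E' Q) {ψn : ℕ → EuclideanSpace ℝ (Fin d) → ℝ}
    {ψ : EuclideanSpace ℝ (Fin d) → ℝ} {B : ℝ}
    (hi : ∀ n, Integrable (fun y => Real.exp (ψn n y)) (Qn n)) (hψc : Continuous ψ)
    (hA : ∀ n y, ψn n y ≤ A + B * ‖y‖) (hA' : ∀ y, ψ y ≤ A + B * ‖y‖)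
    (hu : ∀ R, TendstoUniformlyOn ψn ψ l (Metric.closedBall 0 R)) :
    Tendsto (fun n => ∫ y, Real.exp (ψn n y) ∂(Qn n)) l (𝓝 (∫ y, Real.exp (ψ y) ∂Q)) := by
  set G : EuclideanSpace ℝ (Fin d) → ℝ := fun y => Real.exp A * Real.exp (B * ‖y‖) with hG
  have hG' : ∀ y, G y = Real.exp (A + B * ‖y‖) := fun y => by rw [hG, Real.exp_add]
  have hG0 : ∀ y, 0 ≤ G y := fun y => by positivity
  have hGc : Continuous G := by fun_prop
  have hGi : ∀ n, Integrable G (Qn n) := fun n => ((hQn n).integrable B).const_mul _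
  have hGQ : Integrable G Q := (hQ.integrable B).const_mul _
  have hhG : ∀ y, Real.exp (ψ y) ≤ G y := fun y => by
    rw [hG']; exact Real.exp_le_exp.2 (hA' y)
  have hhi : ∀ n, Integrable (fun y => Real.exp (ψ y)) (Qn n) := fun n =>
    (hGi n).mono' (by fun_prop) (ae_of_all _ fun y => by
      rw [Real.norm_of_nonneg (Real.exp_pos _).le]; exact hhG y)
  have hlim := (hQt (fun y => Real.exp (ψ y)) (by fun_prop) ⟨Real.exp A, B, fun y => by
    rw [abs_of_pos (Real.exp_pos _)]; exact hhG y⟩).mono_left hl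
  have hM : ∀ n, ∫ y, G y ∂(Qn n) ≤ Real.exp A * E B := fun n => by
    rw [hG, integral_const_mul]
    exact mul_le_mul_of_nonneg_left ((hQn n).le B) (Real.exp_pos A).le
  set M := Real.exp A * E B with hMdef
  have hdiff : Tendsto (fun n => ∫ y, Real.exp (ψn n y) ∂(Qn n) - ∫ y, Real.exp (ψ y) ∂(Qn n))
      l (𝓝 0) := by
    rw [Metric.tendsto_nhds]
    intro ε hε
    obtain ⟨m, hm⟩ := exists_integral_tailCutoff_lt hGQ (half_pos hε)
    have htail := ((hQt (fun y => tailCutoff m y * G y)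
      ((continuous_tailCutoff _).mul hGc) ⟨Real.exp A, B, fun y => by
        rw [abs_of_nonneg (mul_nonneg (tailCutoff_nonneg _ _) (hG0 y))]
        exact mul_le_of_le_one_left (hG0 y) (tailCutoff_le_one _ _)⟩).mono_left
        hl).eventually (gt_mem_nhds hm)
    set δ := ε / (2 * (|M| + 1)) with hδ
    have hδ0 : 0 < δ := by positivity
    have hδ' : δ * M < ε / 2 := by
      have h1 : δ * (|M| + 1) = ε / 2 := by rw [hδ]; field_simp
      nlinarith [le_abs_self M]
    filter_upwards [htail, Metric.tendstoUniformlyOn_iff.1 (hu (m + 1)) δ hδ0] with n hn1 hn2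
    rw [dist_zero_right, ← integral_sub (hi n) (hhi n)]
    have hti : Integrable (fun y => tailCutoff m y * G y) (Qn n) :=
      (hGi n).mono' ((continuous_tailCutoff _).mul hGc).aestronglyMeasurable
        (ae_of_all _ fun y => by
          rw [Real.norm_of_nonneg (mul_nonneg (tailCutoff_nonneg _ _) (hG0 y))]
          exact mul_le_of_le_one_left (hG0 y) (tailCutoff_le_one _ _))
    -- On the ball of radius `m + 1` uniform convergence gives the first term; outside, the cutoff
    -- is `1` and the envelope `G` dominates both exponentials.
    have hle : ∀ y, ‖Real.exp (ψn n y) - Real.exp (ψ y)‖ ≤ δ * G y + tailCutoff m y * G y := by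
      intro y
      rcases le_total ‖y‖ (m + 1) with hy | hy
      · have h1 := hn2 y (by simpa using hy)
        rw [dist_comm, Real.dist_eq] at h1
        have h2 := Real.abs_exp_sub_exp_le (hA n y) (hA' y)
        rw [← hG'] at h2
        have h3 := mul_le_mul_of_nonneg_right h1.le (hG0 y)
        have h4 := mul_nonneg (tailCutoff_nonneg (m : ℝ) y) (hG0 y)
        rw [Real.norm_eq_abs]
        linarith
      · rw [tailCutoff_eq_one hy, one_mul, Real.norm_eq_abs, abs_le]
        have h1 : Real.exp (ψn n y) ≤ G y := by rw [hG']; exact Real.exp_le_exp.2 (hA n y)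
        have h2 := hhG y
        have h3 := mul_nonneg hδ0.le (hG0 y)
        constructor <;> linarith [Real.exp_pos (ψn n y), Real.exp_pos (ψ y)]
    calc ‖∫ y, (Real.exp (ψn n y) - Real.exp (ψ y)) ∂(Qn n)‖
        ≤ ∫ y, (δ * G y + tailCutoff m y * G y) ∂(Qn n) :=
          norm_integral_le_of_norm_le (((hGi n).const_mul δ).add hti) (ae_of_all _ hle)
      _ = δ * ∫ y, G y ∂(Qn n) + ∫ y, tailCutoff m y * G y ∂(Qn n) := by
          rw [integral_add ((hGi n).const_mul δ) hti, integral_const_mul]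
      _ < ε := by
          have := mul_le_mul_of_nonneg_left (hM n) hδ0.le
          linarith
  simpa using hdiff.add hlim

/-- A bounded real sequence converges along every ultrafilter. -/
theorem exists_tendsto_ultrafilter {F : ℕ → ℝ} {a b : ℝ} (U : Ultrafilter ℕ)
    (ha : ∀ n, a ≤ F n) (hb : ∀ n, F n ≤ b) : ∃ c, Tendsto F U (𝓝 c) := by
  obtain ⟨c, -, hc⟩ := (isCompact_Icc (a := a) (b := b)).ultrafilter_le_nhds (U.map F) (by
    rw [le_principal_iff]
    exact Filter.mem_map.2 (Eventually.of_forall fun n => ⟨ha n, hb n⟩))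
  exact ⟨c, hc⟩

end Limit

/-! ### Consequences of subgaussianity -/

section Subgaussian

variable {d : ℕ} {P Q : Measure (EuclideanSpace ℝ (Fin d))}

/-- Young's inequality `k‖x‖ ≤ k² dσ² / 2 + ‖x‖² / (2dσ²)`. The quadratic dependence on `k` in the
exponent is what later makes potentials integrable. -/
theorem IsSubgaussian.exists_isExpMomentBound (hP : IsSubgaussian P) :
    ∃ D : ℝ, 0 ≤ D ∧ IsExpMomentBound (fun k => 2 * Real.exp (k ^ 2 * D)) P := by
  obtain ⟨σ, hσ, h⟩ := hP
  rw [IsSubgaussianWith] at h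
  have h0 : Integrable (fun x => Real.exp (‖x‖ ^ 2 / (2 * d * σ ^ 2))) P :=
    (lintegral_ofReal_ne_top_iff_integrable (by fun_prop)
      (ae_of_all _ fun x => (Real.exp_pos _).le)).1 (h.trans_lt (by simp)).ne
  have h2 : ∫ x, Real.exp (‖x‖ ^ 2 / (2 * d * σ ^ 2)) ∂P ≤ 2 := by
    rw [integral_eq_lintegral_of_nonneg_ae (ae_of_all _ fun x => (Real.exp_pos _).le) h0.1]
    exact ENNReal.toReal_le_of_le_ofReal zero_le_two (by simpa using h)
  have hle : ∀ k (x : EuclideanSpace ℝ (Fin d)), Real.exp (k * ‖x‖) ≤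
      Real.exp (k ^ 2 * (d * σ ^ 2 / 2)) * Real.exp (‖x‖ ^ 2 / (2 * d * σ ^ 2)) := by
    intro k x
    rw [← Real.exp_add]
    refine Real.exp_le_exp.2 ?_
    rcases Nat.eq_zero_or_pos d with hd | hd
    · subst hd
      have : ‖x‖ = 0 := by rw [Subsingleton.elim x 0, norm_zero]
      simp [this]
    · have hd' : (0 : ℝ) < d := by exact_mod_cast hd
      have : k ^ 2 * (d * σ ^ 2 / 2) + ‖x‖ ^ 2 / (2 * d * σ ^ 2) - k * ‖x‖ =
          (k * (d * σ ^ 2) - ‖x‖) ^ 2 / (2 * d * σ ^ 2) := by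
        field_simp
        ring
      have h3 : 0 ≤ (k * (d * σ ^ 2) - ‖x‖) ^ 2 / (2 * d * σ ^ 2) := by positivity
      linarith
  have hint : ∀ k, Integrable (fun x => Real.exp (k * ‖x‖)) P := fun k =>
    (h0.const_mul (Real.exp (k ^ 2 * (d * σ ^ 2 / 2)))).mono' (by fun_prop)
      (ae_of_all _ fun x => by rw [Real.norm_of_nonneg (Real.exp_pos _).le]; exact hle k x)
  refine ⟨d * σ ^ 2 / 2, by positivity, hint, fun k => ?_⟩
  refine (integral_mono (hint k) (h0.const_mul _) (hle k)).trans ?_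
  rw [integral_const_mul, mul_comm]
  exact mul_le_mul_of_nonneg_right h2 (Real.exp_pos _).le

/-- With moments of size `2 * exp (k² D)`, `exp_neg_le` becomes a quadratic lower bound for `f`.
Together with the upper bound, `f` grows at most quadratically, hence is dominated by a multiple of
`exp ‖x‖`. -/
theorem DualOptimalityEverywhere.integrable_of_growth {f g : EuclideanSpace ℝ (Fin d) → ℝ}
    {A D : ℝ} {E : ℝ → ℝ} (h : DualOptimalityEverywhere P Q f g) (hP : IsExpMomentBound E P)
    (hD : 0 ≤ D) (hQ : IsExpMomentBound (fun k => 2 * Real.exp (k ^ 2 * D)) Q) (hA : 0 ≤ A)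
    (hfm : AEStronglyMeasurable f P) (hf : ∀ x, f x - ‖x‖ ^ 2 / 2 ≤ A * (1 + ‖x‖))
    (hg : ∀ y, g y - ‖y‖ ^ 2 / 2 ≤ A * (1 + ‖y‖)) : Integrable f P := by
  set C := A + 1 + (A + 1) ^ 2 * D with hC
  refine ((hP.integrable 1).const_mul (2 * C)).mono' hfm (ae_of_all _ fun x => ?_)
  have ht := norm_nonneg x
  set t := ‖x‖ with ht_def
  have hlow : -(f x - t ^ 2 / 2) ≤ A + (1 + (A + t) ^ 2 * D) := by
    have h1 := h.exp_neg_le hQ hg x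
    -- The factor `2` is absorbed by `exp 1`.
    have h2 : Real.exp A * (2 * Real.exp ((A + t) ^ 2 * D)) ≤
        Real.exp (A + (1 + (A + t) ^ 2 * D)) := by
      rw [Real.exp_add, Real.exp_add]
      have := Real.add_one_le_exp 1
      gcongr
      linarith
    exact Real.exp_le_exp.1 (h1.trans h2)
  have hexp : (1 + t) ^ 2 ≤ 2 * Real.exp (1 * t) := by
    rw [one_mul]
    nlinarith [Real.quadratic_le_exp_of_nonneg ht]
  have hAt : (A + t) ^ 2 ≤ ((A + 1) * (1 + t)) ^ 2 := by
    have : A + t ≤ (A + 1) * (1 + t) := by nlinarith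
    gcongr
  have hC' : |f x| ≤ C * (1 + t) ^ 2 := by
    have h1 := hf x
    have h2 := mul_le_mul_of_nonneg_right hAt hD
    have h3 : 0 ≤ (A + 1) ^ 2 * D * (1 + t) ^ 2 := by positivity
    rw [abs_le, hC]
    constructor
    · nlinarith [mul_nonneg hA ht, mul_nonneg hA (sq_nonneg t)]
    · nlinarith [mul_nonneg hA ht, mul_nonneg hA (sq_nonneg t)]
  rw [Real.norm_eq_abs]
  have hC0 : 0 ≤ C := by positivity
  nlinarith [mul_le_mul_of_nonneg_left hexp hC0]

end Subgaussian

/-! ### Stability of potentials under convergence of the marginals -/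

section Stability

variable {d : ℕ} {P Q : Measure (EuclideanSpace ℝ (Fin d))}
  {Pn Qn : ℕ → Measure (EuclideanSpace ℝ (Fin d))}

theorem ExpMomentTendsto.exists_isExpMomentBound (h : ExpMomentTendsto Pn P)
    (hi : ∀ n k, Integrable (fun x => Real.exp (k * ‖x‖)) (Pn n)) :
    ∃ E : ℝ → ℝ, ∀ n, IsExpMomentBound E (Pn n) := by
  have hb : ∀ k : ℝ, ∃ b, ∀ n, ∫ x, Real.exp (k * ‖x‖) ∂(Pn n) ≤ b := fun k => by
    obtain ⟨b, hb⟩ := (h (fun x => Real.exp (k * ‖x‖)) (by fun_prop) ⟨1, k, fun x => by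
      rw [abs_of_pos (Real.exp_pos _), one_mul]⟩).bddAbove_range
    exact ⟨b, fun n => hb ⟨n, rfl⟩⟩
  choose E hE using hb
  exact ⟨E, fun n => ⟨hi n, fun k => hE k n⟩⟩

theorem IsExpMomentBound.mono {E E' : ℝ → ℝ} (h : IsExpMomentBound E P) (hle : ∀ k, E k ≤ E' k) :
    IsExpMomentBound E' P :=
  ⟨h.integrable, fun k => (h.le k).trans (hle k)⟩

/-- A modulus of continuity on balls for centred potentials. -/
noncomputable def potentialLipschitzConst (A : ℝ) (E : ℝ → ℝ) (R : ℝ) : ℝ :=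
  Real.exp (A * (1 + R)) * (Real.exp A * E (A + R + 1))

/-- Both sides of the Laplace transform identity converge: one by pointwise convergence of `fn`, the
other because the uniform Lipschitz bounds make `gn` converge locally uniformly. -/
theorem integral_gibbsDensity_of_tendsto {E E' : ℝ → ℝ} {A : ℝ} {l : Filter ℕ} (hl : l ≤ atTop)
    [l.NeBot] (hQt : ExpMomentTendsto Qn Q) (hPn : ∀ n, IsExpMomentBound E (Pn n))
    (hQn : ∀ n, IsExpMomentBound E (Qn n)) (hQ : IsExpMomentBound E' Q) (hA : 0 ≤ A)
    {fn gn : ℕ → EuclideanSpace ℝ (Fin d) → ℝ}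
    (h : ∀ n, DualOptimalityEverywhere (Pn n) (Qn n) (fn n) (gn n))
    (hfA : ∀ n x, fn n x - ‖x‖ ^ 2 / 2 ≤ A * (1 + ‖x‖))
    (hgA : ∀ n y, gn n y - ‖y‖ ^ 2 / 2 ≤ A * (1 + ‖y‖))
    {f g : EuclideanSpace ℝ (Fin d) → ℝ}
    (hf : ∀ x, Tendsto (fun n => fn n x) l (𝓝 (f x)))
    (hg : ∀ y, Tendsto (fun n => gn n y) l (𝓝 (g y))) (x : EuclideanSpace ℝ (Fin d)) :
    ∫ y, gibbsDensity f g (x, y) ∂Q = 1 := by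
  have hgl : ∀ y, Tendsto (fun n => gn n y - ‖y‖ ^ 2 / 2) l (𝓝 (g y - ‖y‖ ^ 2 / 2)) :=
    fun y => (hg y).sub_const _
  have hL : ∀ n R y y', ‖y‖ ≤ R → ‖y'‖ ≤ R →
      (gn n y - ‖y‖ ^ 2 / 2) - (gn n y' - ‖y'‖ ^ 2 / 2) ≤
        potentialLipschitzConst A E R * ‖y - y'‖ := fun n R y y' hy hy' =>
    (h n).symm.sub_le_mul_norm_sub (hPn n) hA (hgA n) (hfA n) hy hy'
  have hgc : Continuous fun y => g y - ‖y‖ ^ 2 / 2 :=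
    continuous_of_lipschitz_on_balls fun R y y' hy hy' =>
      le_of_tendsto ((hgl y).sub (hgl y')) (Eventually.of_forall fun n => hL n R y y' hy hy')
  have hle : ∀ {a : EuclideanSpace ℝ (Fin d) → ℝ} (y : EuclideanSpace ℝ (Fin d)),
      a y - ‖y‖ ^ 2 / 2 ≤ A * (1 + ‖y‖) →
      a y - ‖y‖ ^ 2 / 2 + inner ℝ x y ≤ A + (A + ‖x‖) * ‖y‖ := fun y hy => by
    nlinarith [real_inner_le_norm x y]
  have hu : ∀ R, TendstoUniformlyOn (fun n y => gn n y - ‖y‖ ^ 2 / 2 + inner ℝ x y)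
      (fun y => g y - ‖y‖ ^ 2 / 2 + inner ℝ x y) l (Metric.closedBall 0 R) := fun R => by
    have := tendstoUniformlyOn_of_lipschitz_on_balls hL hgl (isCompact_closedBall 0 R)
    rw [Metric.tendstoUniformlyOn_iff] at this ⊢
    simpa using this
  have hlim := tendsto_integral_exp_of_tendstoUniformlyOn hl hQt hQn hQ
    (fun n => (h n).integrable_exp_inner x) (by fun_prop) (fun n y => hle y (hgA n y))
    (fun y => hle y (le_of_tendsto (hgl y) (Eventually.of_forall fun n => hgA n y))) hu
  simp only [(h _).integral_exp_inner x] at hlim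
  have hlim' : Tendsto (fun n => Real.exp (-(fn n x - ‖x‖ ^ 2 / 2))) l
      (𝓝 (Real.exp (-(f x - ‖x‖ ^ 2 / 2)))) :=
    (Real.continuous_exp.tendsto _).comp ((hf x).sub_const _).neg
  simp only [DualOptimalityEverywhere.gibbsDensity_eq_exp]
  rw [integral_const_mul, tendsto_nhds_unique hlim hlim', ← Real.exp_add, add_neg_cancel,
    Real.exp_zero]

/-- Sequences of marginals and of normalised potentials, with the marginals converging to
subgaussian limits. -/
structure PotentialSequence (P Q : Measure (EuclideanSpace ℝ (Fin d)))
    (Pn Qn : ℕ → Measure (EuclideanSpace ℝ (Fin d)))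
    (fn gn : ℕ → EuclideanSpace ℝ (Fin d) → ℝ) : Prop where
  isProb_left : ∀ n, IsProbabilityMeasure (Pn n)
  isProb_right : ∀ n, IsProbabilityMeasure (Qn n)
  tendsto_left : ExpMomentTendsto Pn P
  tendsto_right : ExpMomentTendsto Qn Q
  exp_left : ∀ n k, Integrable (fun x => Real.exp (k * ‖x‖)) (Pn n)
  exp_right : ∀ n k, Integrable (fun x => Real.exp (k * ‖x‖)) (Qn n)
  dual : ∀ n, DualOptimalityEverywhere (Pn n) (Qn n) (fn n) (gn n)
  integrable_left : ∀ n, Integrable (fn n) (Pn n)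
  integrable_right : ∀ n, Integrable (gn n) (Qn n)
  apply_zero : ∀ n, fn n 0 = 0

namespace PotentialSequence

variable {fn gn : ℕ → EuclideanSpace ℝ (Fin d) → ℝ}

theorem exists_bounds (h : PotentialSequence P Q Pn Qn fn gn) :
    ∃ (A : ℝ) (E : ℝ → ℝ), 0 ≤ A ∧ (∀ n, IsExpMomentBound E (Pn n)) ∧
      (∀ n, IsExpMomentBound E (Qn n)) ∧ (∀ n x, fn n x - ‖x‖ ^ 2 / 2 ≤ A * (1 + ‖x‖)) ∧
      ∀ n y, gn n y - ‖y‖ ^ 2 / 2 ≤ A * (1 + ‖y‖) := by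
  obtain ⟨E₁, hE₁⟩ := h.tendsto_left.exists_isExpMomentBound h.exp_left
  obtain ⟨E₂, hE₂⟩ := h.tendsto_right.exists_isExpMomentBound h.exp_right
  set E : ℝ → ℝ := fun k => max (E₁ k) (E₂ k) with hE
  have hP : ∀ n, IsExpMomentBound E (Pn n) := fun n => (hE₁ n).mono fun k => le_max_left _ _
  have hQ : ∀ n, IsExpMomentBound E (Qn n) := fun n => (hE₂ n).mono fun k => le_max_right _ _
  have hg : ∀ n, _ := fun n =>
    haveI := h.isProb_left n
    haveI := h.isProb_right n
    (h.dual n).growth_of_apply_zero (hP n) (hQ n) (h.integrable_left n) (h.integrable_right n)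
      (h.apply_zero n)
  refine ⟨2 * E 1 + Real.log (E (E 1)), E, ?_, hP, hQ, fun n => (hg n).1, fun n => (hg n).2⟩
  have := h.isProb_left 0
  have h1 := (hP 0).one_le zero_le_one
  have h2 := Real.log_nonneg ((hP 0).one_le (zero_le_one.trans h1))
  linarith

/-- An ultrafilter gives limits at all points simultaneously, from pointwise bounds alone. The lemma
serves twice: it constructs potentials for `(P, Q)`, and it identifies every cluster point of the
sequence. -/
theorem exists_ultrafilter_limit (h : PotentialSequence P Q Pn Qn fn gn) (hP : IsSubgaussian P)
    (hQ : IsSubgaussian Q) (U : Ultrafilter ℕ) (hU : (U : Filter ℕ) ≤ atTop) :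
    ∃ f g, DualOptimalityEverywhere P Q f g ∧ Integrable f P ∧ Integrable g Q ∧ f 0 = 0 ∧
      (∀ x, Tendsto (fun n => fn n x) U (𝓝 (f x))) ∧
      ∀ y, Tendsto (fun n => gn n y) U (𝓝 (g y)) := by
  obtain ⟨A, E, hA, hPn, hQn, hfA, hgA⟩ := h.exists_bounds
  obtain ⟨D₁, hD₁, hPD⟩ := hP.exists_isExpMomentBound
  obtain ⟨D₂, hD₂, hQD⟩ := hQ.exists_isExpMomentBound
  have key : ∀ {Pn Qn : ℕ → Measure (EuclideanSpace ℝ (Fin d))}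
      {fn gn : ℕ → EuclideanSpace ℝ (Fin d) → ℝ}, (∀ n, IsExpMomentBound E (Qn n)) →
      (∀ n, DualOptimalityEverywhere (Pn n) (Qn n) (fn n) (gn n)) →
      (∀ n x, fn n x - ‖x‖ ^ 2 / 2 ≤ A * (1 + ‖x‖)) →
      (∀ n y, gn n y - ‖y‖ ^ 2 / 2 ≤ A * (1 + ‖y‖)) → ∃ f : EuclideanSpace ℝ (Fin d) → ℝ,
      (∀ x, Tendsto (fun n => fn n x) U (𝓝 (f x))) ∧ Continuous f ∧
      ∀ x, f x - ‖x‖ ^ 2 / 2 ≤ A * (1 + ‖x‖) := by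
    intro Pn Qn fn gn hQn hd hfA hgA
    have hlim : ∀ x, ∃ c, Tendsto (fun n => fn n x) U (𝓝 c) := by
      intro x
      refine exists_tendsto_ultrafilter U
        (a := ‖x‖ ^ 2 / 2 - Real.log (Real.exp A * E (A + ‖x‖))) (b := ‖x‖ ^ 2 / 2 + A * (1 + ‖x‖))
        (fun n => ?_) (fun n => ?_)
      · have h1 := Real.log_le_log (Real.exp_pos _) ((hd n).exp_neg_le (hQn n) (hgA n) x)
        rw [Real.log_exp] at h1
        linarith
      · linarith [hfA n x]
    choose f hf using hlim
    have hf' : ∀ x, Tendsto (fun n => fn n x - ‖x‖ ^ 2 / 2) U (𝓝 (f x - ‖x‖ ^ 2 / 2)) :=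
      fun x => (hf x).sub_const _
    refine ⟨f, hf, ?_, fun x => le_of_tendsto (hf' x) (Eventually.of_forall fun n => hfA n x)⟩
    have hc : Continuous fun x => f x - ‖x‖ ^ 2 / 2 :=
      continuous_of_lipschitz_on_balls (L := potentialLipschitzConst A E) fun R y y' hy hy' =>
        le_of_tendsto ((hf' y).sub (hf' y')) (Eventually.of_forall fun n =>
          (hd n).sub_le_mul_norm_sub (hQn n) hA (hfA n) (hgA n) hy hy')
    have : Continuous fun x => (f x - ‖x‖ ^ 2 / 2) + ‖x‖ ^ 2 / 2 := by fun_prop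
    simpa using this
  obtain ⟨f, hf, hfc, hfA'⟩ := key hQn h.dual hfA hgA
  obtain ⟨g, hg, hgc, hgA'⟩ := key hPn (fun n => (h.dual n).symm) hgA hfA
  have hd : DualOptimalityEverywhere P Q f g := by
    refine ⟨fun x => integral_gibbsDensity_of_tendsto hU h.tendsto_right hPn hQn hQD hA h.dual
      hfA hgA hf hg x, fun y => ?_⟩
    rw [← integral_gibbsDensity_of_tendsto hU h.tendsto_left hQn hPn hPD hA
      (fun n => (h.dual n).symm) hgA hfA hg hf y]
    congr 1
    ext x
    rw [← gibbsDensity_swap]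
    rfl
  refine ⟨f, g, hd, ?_, ?_, ?_, hf, hg⟩
  · exact hd.integrable_of_growth hPD hD₂ hQD hA hfc.aestronglyMeasurable hfA' hgA'
  · exact hd.symm.integrable_of_growth hQD hD₁ hPD hA hgc.aestronglyMeasurable hgA' hfA'
  · exact tendsto_nhds_unique (hf 0) (by simp [h.apply_zero])

/-- Convergence along `atTop` is tested on finer ultrafilters. Each limit differs from `(f, g)` by a
constant, and the value at `0` makes that constant vanish. -/
theorem tendstoUniformlyOn [IsProbabilityMeasure P] [IsProbabilityMeasure Q]
    (h : PotentialSequence P Q Pn Qn fn gn) (hP : IsSubgaussian P)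
    (hQ : IsSubgaussian Q) {f g : EuclideanSpace ℝ (Fin d) → ℝ}
    (hd : DualOptimalityEverywhere P Q f g) (hf : Integrable f P) (hg : Integrable g Q)
    (h0 : f 0 = 0) {K : Set (EuclideanSpace ℝ (Fin d))} (hK : IsCompact K) :
    TendstoUniformlyOn fn f atTop K ∧ TendstoUniformlyOn gn g atTop K := by
  have hpt : ∀ U : Ultrafilter ℕ, (U : Filter ℕ) ≤ atTop →
      (∀ x, Tendsto (fun n => fn n x) U (𝓝 (f x))) ∧
      ∀ y, Tendsto (fun n => gn n y) U (𝓝 (g y)) := by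
    intro U hU
    obtain ⟨f', g', hd', hf', hg', h0', hlf, hlg⟩ := h.exists_ultrafilter_limit hP hQ U hU
    obtain ⟨c, hc, hc'⟩ := hd.exists_eq_add_const hd' hf hg hf' hg'
    have hc0 : c = 0 := by simpa [h0, h0'] using (hc 0).symm
    simp only [hc0, add_zero, sub_zero] at hc hc'
    exact ⟨fun x => hc x ▸ hlf x, fun y => hc' y ▸ hlg y⟩
  obtain ⟨A, E, hA, hPn, hQn, hfA, hgA⟩ := h.exists_bounds
  have h1 := tendstoUniformlyOn_of_lipschitz_on_balls
    (F := fun n x => fn n x - ‖x‖ ^ 2 / 2) (L := potentialLipschitzConst A E)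
    (fun n R x x' hx hx' => (h.dual n).sub_le_mul_norm_sub (hQn n) hA (hfA n) (hgA n) hx hx')
    (fun x => (tendsto_iff_ultrafilter _ _ _).2 fun U hU => ((hpt U hU).1 x).sub_const _) hK
  have h2 := tendstoUniformlyOn_of_lipschitz_on_balls
    (F := fun n x => gn n x - ‖x‖ ^ 2 / 2) (L := potentialLipschitzConst A E)
    (fun n R x x' hx hx' => (h.dual n).symm.sub_le_mul_norm_sub (hPn n) hA (hgA n) (hfA n) hx hx')
    (fun x => (tendsto_iff_ultrafilter _ _ _).2 fun U hU => ((hpt U hU).2 x).sub_const _) hK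
  rw [Metric.tendstoUniformlyOn_iff] at h1 h2
  simp only [dist_sub_right] at h1 h2
  exact ⟨Metric.tendstoUniformlyOn_iff.2 h1, Metric.tendstoUniformlyOn_iff.2 h2⟩

end PotentialSequence

end Stability

/-! ### Convergence of empirical measures -/

section Empirical

theorem integrable_empiricalMeasure {E : Type*} [MeasurableSpace E] [MeasurableSingletonClass E]
    (x : ℕ → E) {n : ℕ} (hn : 1 ≤ n) (h : E → ℝ) : Integrable h (empiricalMeasure x n) := by
  refine Integrable.smul_measure ?_ (by simp; omega)
  exact integrable_finsetSum_measure.2 fun i _ => integrable_dirac (by simp)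

theorem integral_empiricalMeasure {E : Type*} [MeasurableSpace E] [MeasurableSingletonClass E]
    (x : ℕ → E) (n : ℕ) (h : E → ℝ) :
    ∫ y, h y ∂(empiricalMeasure x n) = (∑ i ∈ Finset.range n, h (x i)) / n := by
  rw [empiricalMeasure, integral_smul_measure, integral_finsetSum_measure
    fun i _ => integrable_dirac (by simp)]
  simp [div_eq_inv_mul]

theorem isProbabilityMeasure_empiricalMeasure {E : Type*} [MeasurableSpace E]
    (x : ℕ → E) {n : ℕ} (hn : 1 ≤ n) : IsProbabilityMeasure (empiricalMeasure x n) := by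
  constructor
  simp only [empiricalMeasure, Measure.smul_apply, Measure.coe_finsetSum, Finset.sum_apply,
    measure_univ, Finset.sum_const, Finset.card_range, nsmul_eq_mul, mul_one, smul_eq_mul]
  exact ENNReal.inv_mul_cancel (by simp; omega) (by simp)

variable {d : ℕ} {Ω : Type*} [MeasurableSpace Ω] {μ : Measure Ω}
  {P : Measure (EuclideanSpace ℝ (Fin d))} {X : ℕ → Ω → EuclideanSpace ℝ (Fin d)}

theorem ae_tendsto_integral_empiricalMeasure (hX : ∀ i, HasLaw (X i) P μ) (hXi : iIndepFun X μ)
    {h : EuclideanSpace ℝ (Fin d) → ℝ} (hm : Measurable h) (hi : Integrable h P) :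
    ∀ᵐ ω ∂μ, Tendsto (fun n => ∫ x, h x ∂(empiricalMeasure (fun i => X i ω) n)) atTop
      (𝓝 (∫ x, h x ∂P)) := by
  have hint : Integrable (fun ω => h (X 0 ω)) μ := by
    rw [← (hX 0).map_eq] at hi
    exact hi.comp_aemeasurable (hX 0).aemeasurable
  have key := strong_law_ae_real (fun i ω => h (X i ω)) hint
    (fun i j hij => (hXi.indepFun hij).comp hm hm)
    (fun i => (IdentDistrib.mk (hX i).aemeasurable (hX 0).aemeasurable
      ((hX i).map_eq.trans (hX 0).map_eq.symm)).comp hm)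
  have hval : ∫ ω, h (X 0 ω) ∂μ = ∫ x, h x ∂P := by
    rw [← (hX 0).map_eq, integral_map (hX 0).aemeasurable hm.aestronglyMeasurable]
  simpa only [integral_empiricalMeasure, hval] using key

/-- The exceptional null set must not depend on `h`. The strong law is therefore applied only to
countably many functions: a dense sequence of continuous functions truncated to balls, and
exponential tails. Every admissible `h` is approximated by these. -/
theorem ae_expMomentTendsto_empiricalMeasure [IsProbabilityMeasure P]
    (hX : ∀ i, HasLaw (X i) P μ) (hXi : iIndepFun X μ)
    (hP : ∀ k, Integrable (fun x => Real.exp (k * ‖x‖)) P) :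
    ∀ᵐ ω ∂μ, ExpMomentTendsto (fun n => empiricalMeasure (fun i => X i ω) (n + 1)) P := by
  let p : ℕ → C(EuclideanSpace ℝ (Fin d), ℝ) := TopologicalSpace.denseSeq _
  let B : ℕ → Set (EuclideanSpace ℝ (Fin d)) := fun m => Metric.closedBall 0 m
  have hBm : ∀ m, MeasurableSet (B m) := fun m => Metric.isClosed_closedBall.measurableSet
  have hpi : ∀ m j, Integrable ((B m).indicator (p j)) P := fun m j => by
    have hcpt : IsCompact (B m) := isCompact_closedBall _ _
    obtain ⟨C, hC⟩ := hcpt.exists_bound_of_continuousOn (p j).continuous.continuousOn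
    rw [integrable_indicator_iff (hBm m)]
    exact Measure.integrableOn_of_bounded (M := C) (measure_ne_top _ _)
      (p j).continuous.aestronglyMeasurable
      ((ae_restrict_iff' (hBm m)).2 (ae_of_all _ fun x hx => hC x hx))
  have h1 : ∀ᵐ ω ∂μ, ∀ m j, Tendsto (fun n => ∫ x, (B m).indicator (p j) x
      ∂(empiricalMeasure (fun i => X i ω) n)) atTop (𝓝 (∫ x, (B m).indicator (p j) x ∂P)) :=
    ae_all_iff.2 fun m => ae_all_iff.2 fun j =>
      ae_tendsto_integral_empiricalMeasure hX hXi
        ((p j).continuous.measurable.indicator (hBm m)) (hpi m j)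
  have h2 : ∀ᵐ ω ∂μ, ∀ m k : ℕ, Tendsto (fun n => ∫ x, tailCutoff m x * Real.exp (k * ‖x‖)
      ∂(empiricalMeasure (fun i => X i ω) n)) atTop
        (𝓝 (∫ x, tailCutoff m x * Real.exp (k * ‖x‖) ∂P)) :=
    ae_all_iff.2 fun m => ae_all_iff.2 fun k =>
      ae_tendsto_integral_empiricalMeasure hX hXi
        ((continuous_tailCutoff _).mul (by fun_prop)).measurable
        ((hP k).bdd_mul (c := 1) (continuous_tailCutoff _).aestronglyMeasurable
          (ae_of_all _ fun x => by
            rw [Real.norm_of_nonneg (tailCutoff_nonneg _ x)]; exact tailCutoff_le_one _ x))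
  filter_upwards [h1, h2] with ω h1 h2
  suffices H : ∀ h : EuclideanSpace ℝ (Fin d) → ℝ, Continuous h →
      (∃ C k : ℝ, ∀ x, |h x| ≤ C * Real.exp (k * ‖x‖)) →
      Tendsto (fun n => ∫ x, h x ∂(empiricalMeasure (fun i => X i ω) n)) atTop
        (𝓝 (∫ x, h x ∂P)) from fun h hc hb => (H h hc hb).comp (tendsto_add_atTop_nat 1)
  intro h hc ⟨C, k₀, hb⟩
  obtain ⟨k, hk⟩ := exists_nat_ge k₀
  have hC : 0 ≤ C := by
    have := (abs_nonneg _).trans (hb 0)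
    simpa using this
  replace hb : ∀ x, |h x| ≤ C * Real.exp (k * ‖x‖) := fun x => (hb x).trans (by gcongr)
  have hhP : Integrable h P := ((hP k).const_mul C).mono' hc.aestronglyMeasurable
    (ae_of_all _ hb)
  rw [Metric.tendsto_nhds]
  intro ε hε
  -- Five errors are below or at most `δ`: two approximations on the ball, two tails, and one strong
  -- law.
  set δ := ε / 6 with hδ
  have hδ0 : 0 < δ := by positivity
  obtain ⟨m, hm⟩ := exists_integral_tailCutoff_lt ((hP k).const_mul C) hδ0
  -- Density is in the compact-open topology, that is, uniformly on the ball.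
  obtain ⟨j, hj⟩ : ∃ j, ∀ x ∈ B (m + 1), |h x - p j x| < δ := by
    have hcpt : IsCompact (B (m + 1)) := isCompact_closedBall _ _
    have hnhds : {q : C(EuclideanSpace ℝ (Fin d), ℝ) | ∀ x ∈ B (m + 1), dist (h x) (q x) < δ} ∈
        𝓝 (⟨h, hc⟩ : C(EuclideanSpace ℝ (Fin d), ℝ)) := by
      have := (ContinuousMap.tendsto_iff_forall_isCompact_tendstoUniformlyOn
        (F := fun q : C(EuclideanSpace ℝ (Fin d), ℝ) => q) (f := ⟨h, hc⟩)).1 tendsto_id _ hcpt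
      exact Metric.tendstoUniformlyOn_iff.1 this δ hδ0
    obtain ⟨_, ⟨j, rfl⟩, hq⟩ := (TopologicalSpace.denseRange_denseSeq _).inter_nhds_nonempty hnhds
    exact ⟨j, fun x hx => hq x hx⟩
  have hpt : ∀ x, ‖h x - (B (m + 1)).indicator (p j) x‖ ≤
      δ + tailCutoff m x * (C * Real.exp (k * ‖x‖)) := by
    intro x
    have h3 : 0 ≤ tailCutoff m x * (C * Real.exp (k * ‖x‖)) :=
      mul_nonneg (tailCutoff_nonneg _ _) (by positivity)
    by_cases hx : x ∈ B (m + 1)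
    · rw [Set.indicator_of_mem hx, Real.norm_eq_abs]
      linarith [hj x hx]
    · have hx' : (m : ℝ) + 1 ≤ ‖x‖ := by
        simp only [B, Metric.mem_closedBall, dist_zero_right, not_le] at hx
        push_cast at hx
        exact hx.le
      rw [Set.indicator_of_notMem hx, sub_zero, tailCutoff_eq_one hx', one_mul, Real.norm_eq_abs]
      linarith [hb x]
  have hest : ∀ ν : Measure (EuclideanSpace ℝ (Fin d)), IsProbabilityMeasure ν →
      Integrable h ν → Integrable ((B (m + 1)).indicator (p j)) ν →
      Integrable (fun x => tailCutoff m x * (C * Real.exp (k * ‖x‖))) ν →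
      |∫ x, h x ∂ν - ∫ x, (B (m + 1)).indicator (p j) x ∂ν| ≤
        δ + ∫ x, tailCutoff m x * (C * Real.exp (k * ‖x‖)) ∂ν := by
    intro ν _ hν1 hν2 hν3
    rw [← integral_sub hν1 hν2]
    have := norm_integral_le_of_norm_le ((integrable_const δ).add hν3) (ae_of_all ν hpt)
    simpa [integral_add (integrable_const δ) hν3] using this
  have htP : Integrable (fun x => tailCutoff m x * (C * Real.exp (k * ‖x‖))) P :=
    ((hP k).const_mul C).bdd_mul (c := 1) (continuous_tailCutoff _).aestronglyMeasurable
      (ae_of_all _ fun x => by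
        rw [Real.norm_of_nonneg (tailCutoff_nonneg _ x)]; exact tailCutoff_le_one _ x)
  have hPe := hest P inferInstance hhP (hpi _ _) htP
  have htail : Tendsto (fun n => ∫ x, tailCutoff m x * (C * Real.exp (k * ‖x‖))
      ∂(empiricalMeasure (fun i => X i ω) n)) atTop
      (𝓝 (∫ x, tailCutoff m x * (C * Real.exp (k * ‖x‖)) ∂P)) := by
    simp only [mul_left_comm _ C, integral_const_mul]
    exact (h2 m k).const_mul C
  filter_upwards [htail.eventually (gt_mem_nhds hm),
    Metric.tendsto_nhds.1 (h1 (m + 1) j) δ hδ0, eventually_ge_atTop 1] with n hn1 hn2 hn3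
  have hne := hest _ (isProbabilityMeasure_empiricalMeasure (fun i => X i ω) hn3)
    (integrable_empiricalMeasure _ hn3 _) (integrable_empiricalMeasure _ hn3 _)
    (integrable_empiricalMeasure _ hn3 _)
  rw [Real.dist_eq, abs_lt] at hn2 ⊢
  rw [abs_le] at hne hPe
  constructor <;> linarith [hne.1, hne.2, hPe.1, hPe.2, hn2.1, hn2.2]

end Empirical

/-! ### Potentials for empirical measures -/

section FiniteSchroedinger

variable {ι κ : Type*} [Fintype ι] [Fintype κ]

/-- The objective whose critical points solve the finite Schrödinger system. -/
noncomputable def schroedingerObjective (K : ι → κ → ℝ) (w : (ι → ℝ) × (κ → ℝ)) : ℝ :=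
  ∑ i, ∑ j, (K i j * Real.exp (w.1 i + w.2 j) - (w.1 i + w.2 j))

/-- Coercivity of one summand of the objective. For `s ≥ 0`, `exp s ≥ s² / 2`, and `2 / c` completes
the square in `c s² / 2 - 2 s`. -/
theorem Real.abs_sub_two_div_le_mul_exp_sub {c : ℝ} (hc : 0 < c) (s : ℝ) :
    |s| - 2 / c ≤ c * Real.exp s - s := by
  rcases le_total s 0 with hs | hs
  · rw [abs_of_nonpos hs]
    have : 0 < c * Real.exp s := by positivity
    have : 0 < 2 / c := by positivity
    linarith
  · rw [abs_of_nonneg hs]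
    have h1 := mul_le_mul_of_nonneg_left (Real.quadratic_le_exp_of_nonneg hs) hc.le
    have h2 : 0 ≤ c / 2 * (s - 2 / c) ^ 2 := by positivity
    have h3 : c / 2 * (s - 2 / c) ^ 2 = c * (s ^ 2 / 2) - 2 * s + 2 / c := by
      field_simp
      ring
    nlinarith

/-- The objective controls only the sums `w.1 i + w.2 j`, being invariant under opposite shifts of
the two components. Normalising the first component to vanish at `i₀` restores compactness of the
sublevel set. -/
theorem exists_isMin_schroedingerObjective [Nonempty ι] {K : ι → κ → ℝ}
    (hK : ∀ i j, 0 < K i j) :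
    ∃ w, ∀ w', schroedingerObjective K w ≤ schroedingerObjective K w' := by
  obtain ⟨i₀⟩ := ‹Nonempty ι›
  set M := schroedingerObjective K (0, 0) + ∑ i, ∑ j, 2 / K i j with hM
  have hbound : ∀ w, schroedingerObjective K w ≤ schroedingerObjective K (0, 0) →
      ∀ i j, |w.1 i + w.2 j| ≤ M := by
    intro w hw i j
    have h1 : ∑ i, ∑ j, (|w.1 i + w.2 j| - 2 / K i j) ≤ schroedingerObjective K w :=
      Finset.sum_le_sum fun i _ => Finset.sum_le_sum fun j _ =>
        Real.abs_sub_two_div_le_mul_exp_sub (hK i j) _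
    simp only [Finset.sum_sub_distrib] at h1
    have h2 : |w.1 i + w.2 j| ≤ ∑ j, |w.1 i + w.2 j| :=
      Finset.single_le_sum (f := fun j => |w.1 i + w.2 j|) (fun _ _ => abs_nonneg _)
        (Finset.mem_univ j)
    have h3 : ∑ j, |w.1 i + w.2 j| ≤ ∑ i, ∑ j, |w.1 i + w.2 j| :=
      Finset.single_le_sum (f := fun i => ∑ j, |w.1 i + w.2 j|)
        (fun _ _ => Finset.sum_nonneg fun _ _ => abs_nonneg _) (Finset.mem_univ i)
    linarith
  have hcont : Continuous (schroedingerObjective K) := by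
    unfold schroedingerObjective
    fun_prop
  by_cases hκ : Nonempty κ
  · obtain ⟨j₀⟩ := hκ
    have hM0 : 0 ≤ M := (abs_nonneg _).trans (hbound (0, 0) le_rfl i₀ j₀)
    -- Row `i₀` gives `|v.2 j| ≤ M`; subtracting this from the bound on the sums gives `|v.1 i| ≤ 2
    -- * M`.
    set C : Set ((ι → ℝ) × (κ → ℝ)) :=
      (Set.pi Set.univ fun _ => Set.Icc (-(2 * M)) (2 * M)) ×ˢ
        (Set.pi Set.univ fun _ => Set.Icc (-M) M) with hC
    have hCc : IsCompact C :=
      (isCompact_univ_pi fun _ => isCompact_Icc).prod (isCompact_univ_pi fun _ => isCompact_Icc)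
    have h0 : ((0, 0) : (ι → ℝ) × (κ → ℝ)) ∈ C := by
      simp only [hC, Set.mem_prod, Set.mem_pi, Set.mem_Icc, Pi.zero_apply]
      exact ⟨fun _ _ => by constructor <;> linarith, fun _ _ => by constructor <;> linarith⟩
    obtain ⟨w, -, hw⟩ := hCc.exists_isMinOn ⟨_, h0⟩ hcont.continuousOn
    refine ⟨w, fun w' => ?_⟩
    set v : (ι → ℝ) × (κ → ℝ) := (fun i => w'.1 i - w'.1 i₀, fun j => w'.2 j + w'.1 i₀) with hv
    have hvw : schroedingerObjective K v = schroedingerObjective K w' := by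
      simp only [schroedingerObjective, hv, sub_add_eq_add_sub]
      refine Finset.sum_congr rfl fun i _ => Finset.sum_congr rfl fun j _ => ?_
      ring_nf
    rw [← hvw]
    rcases le_total (schroedingerObjective K v) (schroedingerObjective K (0, 0)) with h | h
    · refine hw ?_
      have hb := hbound v h
      have hi₀ : v.1 i₀ = 0 := by simp [hv]
      have hj : ∀ j, |v.2 j| ≤ M := fun j => by simpa [hi₀] using hb i₀ j
      simp only [hC, Set.mem_prod, Set.mem_pi, Set.mem_Icc]
      refine ⟨fun i _ => ?_, fun j _ => abs_le.1 (hj j)⟩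
      have h1 := abs_le.1 (hb i j₀)
      have h2 := abs_le.1 (hj j₀)
      constructor <;> linarith [h1.1, h1.2, h2.1, h2.2]
    · exact (hw h0).trans h
  · rw [not_nonempty_iff] at hκ
    exact ⟨(0, 0), fun w' => by simp [schroedingerObjective]⟩

/-- Stationarity of the objective when only the `i`-th coordinate moves. -/
theorem sum_eq_card_of_isMin_left [DecidableEq ι] {K : ι → κ → ℝ} {w : (ι → ℝ) × (κ → ℝ)}
    (hw : ∀ w', schroedingerObjective K w ≤ schroedingerObjective K w') (i : ι) :
    ∑ j, K i j * Real.exp (w.1 i + w.2 j) = Fintype.card κ := by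
  set S := ∑ j, K i j * Real.exp (w.1 i + w.2 j) with hS
  have hrow : ∀ s : ℝ, schroedingerObjective K (w.1 + Pi.single i s, w.2) -
      schroedingerObjective K w = Real.exp s * S - S - Fintype.card κ * s := by
    intro s
    simp only [schroedingerObjective, ← Finset.sum_sub_distrib]
    rw [Finset.sum_eq_single i]
    · have : ∀ j, K i j * Real.exp ((w.1 + Pi.single i s : ι → ℝ) i + w.2 j) -
          ((w.1 + Pi.single i s : ι → ℝ) i + w.2 j) - (K i j * Real.exp (w.1 i + w.2 j) -
          (w.1 i + w.2 j)) = Real.exp s * (K i j * Real.exp (w.1 i + w.2 j)) -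
          K i j * Real.exp (w.1 i + w.2 j) - s := by
        intro j
        rw [Pi.add_apply, Pi.single_eq_same,
          show w.1 i + s + w.2 j = s + (w.1 i + w.2 j) by ring, Real.exp_add s]
        ring
      rw [Finset.sum_congr rfl fun j _ => this j]
      simp only [Finset.sum_sub_distrib, ← Finset.mul_sum, Finset.sum_const,
        Finset.card_univ, nsmul_eq_mul, hS]
    · intro i' _ hi'
      simp [Pi.single_eq_of_ne hi']
    · simp
  have hmin : IsLocalMin (fun s : ℝ => Real.exp s * S - S - Fintype.card κ * s) 0 := by
    refine Eventually.of_forall fun s => ?_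
    have := hw (w.1 + Pi.single i s, w.2)
    simp only [Real.exp_zero, one_mul, sub_self, mul_zero]
    rw [← hrow s]
    linarith
  have hder : HasDerivAt (fun s : ℝ => Real.exp s * S - S - Fintype.card κ * s)
      (Real.exp 0 * S - Fintype.card κ * 1) 0 :=
    (((Real.hasDerivAt_exp 0).mul_const S).sub_const S).sub
      ((hasDerivAt_id (0 : ℝ)).const_mul _)
  have := hmin.hasDerivAt_eq_zero hder
  rw [Real.exp_zero] at this
  linarith

theorem schroedingerObjective_swap (K : ι → κ → ℝ) (w : (ι → ℝ) × (κ → ℝ)) :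
    schroedingerObjective (fun j i => K i j) w.swap = schroedingerObjective K w := by
  simp only [schroedingerObjective, Prod.fst_swap, Prod.snd_swap]
  rw [Finset.sum_comm]
  simp only [add_comm (w.2 _)]

/-- Solvability of the finite Schrödinger system with a positive kernel. -/
theorem exists_schroedinger_system [Nonempty ι] {K : ι → κ → ℝ} (hK : ∀ i j, 0 < K i j) :
    ∃ (a : ι → ℝ) (b : κ → ℝ), (∀ i, ∑ j, K i j * Real.exp (a i + b j) = Fintype.card κ) ∧
      ∀ j, ∑ i, K i j * Real.exp (a i + b j) = Fintype.card ι := by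
  classical
  obtain ⟨w, hw⟩ := exists_isMin_schroedingerObjective hK
  refine ⟨w.1, w.2, sum_eq_card_of_isMin_left hw, fun j => ?_⟩
  have h := sum_eq_card_of_isMin_left (K := fun j i => K i j) (w := w.swap) (fun w' => by
    rw [schroedingerObjective_swap, ← Prod.swap_swap w', schroedingerObjective_swap]
    exact hw _) j
  simpa only [Prod.fst_swap, Prod.snd_swap, add_comm (w.2 j)] using h

end FiniteSchroedinger

/-- The Schrödinger system fixes values at the sample points. Solving each dual equation for its
free variable extends them to the whole space. -/
theorem exists_dualOptimalityEverywhere_empiricalMeasure {d : ℕ}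
    (x y : ℕ → EuclideanSpace ℝ (Fin d)) {n : ℕ} (hn : 1 ≤ n) :
    ∃ f g : EuclideanSpace ℝ (Fin d) → ℝ,
      DualOptimalityEverywhere (empiricalMeasure x n) (empiricalMeasure y n) f g := by
  have : Nonempty (Fin n) := ⟨⟨0, hn⟩⟩
  have hn0 : (0 : ℝ) < n := by exact_mod_cast hn
  obtain ⟨a, b, ha, hb⟩ := exists_schroedinger_system
    (K := fun i j : Fin n => Real.exp (-(‖x i - y j‖ ^ 2 / 2))) fun _ _ => Real.exp_pos _
  simp only [Fintype.card_fin, ← Real.exp_add] at ha hb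
  let f : EuclideanSpace ℝ (Fin d) → ℝ := fun z =>
    -Real.log ((∑ j : Fin n, Real.exp (b j - ‖z - y j‖ ^ 2 / 2)) / n)
  let g : EuclideanSpace ℝ (Fin d) → ℝ := fun z =>
    -Real.log ((∑ i : Fin n, Real.exp (a i - ‖x i - z‖ ^ 2 / 2)) / n)
  have hpos : ∀ u : Fin n → ℝ, 0 < (∑ j, Real.exp (u j)) / n := fun u =>
    div_pos (Finset.sum_pos (fun _ _ => Real.exp_pos _) Finset.univ_nonempty) hn0
  have hf : ∀ z, Real.exp (f z) * ((∑ j : Fin n, Real.exp (b j - ‖z - y j‖ ^ 2 / 2)) / n) = 1 :=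
    fun z => by
      simp only [f]
      rw [Real.exp_neg, Real.exp_log (hpos _), inv_mul_cancel₀ (hpos _).ne']
  have hg : ∀ z, Real.exp (g z) * ((∑ i : Fin n, Real.exp (a i - ‖x i - z‖ ^ 2 / 2)) / n) = 1 :=
    fun z => by
      simp only [g]
      rw [Real.exp_neg, Real.exp_log (hpos _), inv_mul_cancel₀ (hpos _).ne']
  -- The row equations say that the extension agrees with `a` at the samples; in particular repeated
  -- sample points cause no conflict.
  have hfx : ∀ i : Fin n, f (x i) = a i := by
    intro i
    have h1 : (∑ j : Fin n, Real.exp (b j - ‖x i - y j‖ ^ 2 / 2)) / n = Real.exp (-a i) := by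
      rw [div_eq_iff hn0.ne', ← ha i, Finset.mul_sum]
      refine Finset.sum_congr rfl fun j _ => ?_
      rw [← Real.exp_add]
      ring_nf
    simp only [f, h1, Real.log_exp, neg_neg]
  have hgy : ∀ j : Fin n, g (y j) = b j := by
    intro j
    have h1 : (∑ i : Fin n, Real.exp (a i - ‖x i - y j‖ ^ 2 / 2)) / n = Real.exp (-b j) := by
      rw [div_eq_iff hn0.ne', ← hb j, Finset.mul_sum]
      refine Finset.sum_congr rfl fun i _ => ?_
      rw [← Real.exp_add]
      ring_nf
    simp only [g, h1, Real.log_exp, neg_neg]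
  refine ⟨f, g, fun z => ?_, fun z => ?_⟩
  · rw [integral_empiricalMeasure, Finset.sum_range]
    simp only [hgy]
    rw [← hf z, ← mul_div_assoc, Finset.mul_sum]
    simp only [← Real.exp_add, add_sub_assoc]
  · rw [integral_empiricalMeasure, Finset.sum_range]
    simp only [hfx]
    rw [← hg z, ← mul_div_assoc, Finset.mul_sum]
    simp only [← Real.exp_add, add_sub_assoc, add_comm (a _) (g z)]

/-! ### The main theorem -/

theorem proposition8 {d : ℕ} {Ω : Type*} [MeasurableSpace Ω] (μ : Measure Ω)
    [IsProbabilityMeasure μ] (P Q : Measure (EuclideanSpace ℝ (Fin d)))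
    [IsProbabilityMeasure P] [IsProbabilityMeasure Q]
    (hP : IsSubgaussian P) (hQ : IsSubgaussian Q)
    (X Y : ℕ → Ω → EuclideanSpace ℝ (Fin d))
    (hX : ∀ i, HasLaw (X i) P μ) (hY : ∀ i, HasLaw (Y i) Q μ)
    (hXi : iIndepFun X μ) (hYi : iIndepFun Y μ) :
    ∃ f g : EuclideanSpace ℝ (Fin d) → ℝ,
      IsOptimalPotentials P Q f g ∧ DualOptimalityEverywhere P Q f g ∧
      ∃ fn gn : ℕ → Ω → EuclideanSpace ℝ (Fin d) → ℝ,
        (∀ n, 1 ≤ n → ∀ ω,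
          IsOptimalPotentials (empiricalMeasure (fun i => X i ω) n)
            (empiricalMeasure (fun i => Y i ω) n) (fn n ω) (gn n ω) ∧
          DualOptimalityEverywhere (empiricalMeasure (fun i => X i ω) n)
            (empiricalMeasure (fun i => Y i ω) n) (fn n ω) (gn n ω)) ∧
        ∀ᵐ ω ∂μ, ∀ K : Set (EuclideanSpace ℝ (Fin d)), IsCompact K →
          TendstoUniformlyOn (fun n => fn n ω) f atTop K ∧
          TendstoUniformlyOn (fun n => gn n ω) g atTop K := by
  have hexists : ∀ (n : ℕ) (ω : Ω), ∃ p : (EuclideanSpace ℝ (Fin d) → ℝ) ×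
      (EuclideanSpace ℝ (Fin d) → ℝ), 1 ≤ n →
      DualOptimalityEverywhere (empiricalMeasure (fun i => X i ω) n)
        (empiricalMeasure (fun i => Y i ω) n) p.1 p.2 ∧ p.1 0 = 0 := by
    intro n ω
    by_cases hn : 1 ≤ n
    · obtain ⟨f, g, h⟩ := exists_dualOptimalityEverywhere_empiricalMeasure
        (fun i => X i ω) (fun i => Y i ω) hn
      exact ⟨(fun x => f x + -f 0, fun y => g y - -f 0), fun _ => ⟨h.add_const _, by simp⟩⟩
    · exact ⟨(0, 0), fun h => absurd h hn⟩
  choose p hp using hexists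
  obtain ⟨D₁, -, hPD⟩ := hP.exists_isExpMomentBound
  obtain ⟨D₂, -, hQD⟩ := hQ.exists_isExpMomentBound
  have hseq : ∀ᵐ ω ∂μ, PotentialSequence P Q
      (fun n => empiricalMeasure (fun i => X i ω) (n + 1))
      (fun n => empiricalMeasure (fun i => Y i ω) (n + 1))
      (fun n => (p (n + 1) ω).1) (fun n => (p (n + 1) ω).2) := by
    filter_upwards [ae_expMomentTendsto_empiricalMeasure hX hXi hPD.integrable,
      ae_expMomentTendsto_empiricalMeasure hY hYi hQD.integrable] with ω h1 h2
    have hn : ∀ n, 1 ≤ n + 1 := fun n => Nat.le_add_left 1 n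
    exact
      { isProb_left := fun n => isProbabilityMeasure_empiricalMeasure _ (hn n)
        isProb_right := fun n => isProbabilityMeasure_empiricalMeasure _ (hn n)
        tendsto_left := h1
        tendsto_right := h2
        exp_left := fun n k => integrable_empiricalMeasure _ (hn n) _
        exp_right := fun n k => integrable_empiricalMeasure _ (hn n) _
        dual := fun n => (hp _ ω (hn n)).1
        integrable_left := fun n => integrable_empiricalMeasure _ (hn n) _
        integrable_right := fun n => integrable_empiricalMeasure _ (hn n) _
        apply_zero := fun n => (hp _ ω (hn n)).2 }
  -- A single good sample path yields the deterministic pair; uniqueness lets it serve as the limit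
  -- for almost every other path.
  obtain ⟨ω₀, hω₀⟩ := hseq.exists
  obtain ⟨f, g, hd, hf, hg, h0, -, -⟩ := hω₀.exists_ultrafilter_limit hP hQ (hyperfilter ℕ)
    Nat.hyperfilter_le_atTop
  refine ⟨f, g, hd.isOptimalPotentials hf hg, hd, fun n ω => (p n ω).1, fun n ω => (p n ω).2,
    fun n hn ω => ?_, ?_⟩
  · have := isProbabilityMeasure_empiricalMeasure (fun i => X i ω) hn
    have := isProbabilityMeasure_empiricalMeasure (fun i => Y i ω) hn
    exact ⟨(hp n ω hn).1.isOptimalPotentials (integrable_empiricalMeasure _ hn _)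
      (integrable_empiricalMeasure _ hn _), (hp n ω hn).1⟩
  · filter_upwards [hseq] with ω hω K hK
    obtain ⟨h1, h2⟩ := hω.tendstoUniformlyOn hP hQ hd hf hg h0 hK
    rw [Metric.tendstoUniformlyOn_iff] at h1 h2
    simp only [Metric.tendstoUniformlyOn_iff]
    -- Undoes the index shift by one, which keeps the degenerate case `n = 0` out of
    -- `PotentialSequence`.
    rw [← map_add_atTop_eq_nat 1]
    exact ⟨fun ε hε => Filter.eventually_map.2 (h1 ε hε),
      fun ε hε => Filter.eventually_map.2 (h2 ε hε)⟩
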